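/- Let $n\ge 2$ and let $h_1>h_2>\dots>h_n>0$ be real numbers such that the numbers $\xi_i=\frac{h_1}{h_i}-1$, $i=1,\dots,n$, are pairwise rationally dependent (for all $i,j$ there are integers $(p,q)\neq(0,0)$ with $p\,\xi_i+q\,\xi_j=0$). Let $V_{\mathrm{Kep}}(x)=-1/|x|$ on $\mathbb R^2\setminus\{0\}$. For a smooth Riemannian metric $g$ on $\mathbb R^2$ (the origin included), call $g$ rotationally invariant if every linear isometry of the Euclidean plane is an isometry of $g$, so that $g=a(\rho)^2d\rho^2+b(\rho)^2d\theta^2$ in polar coordinates. Let $H(x,v)=\frac12 g_x(v,v)+V_{\mathrm{Kep}}(x)$. The system $(g,V_{\mathrm{Kep}})$ is Zoll on the level $\{H=e\}$, $e<0$, if all non-collision orbits of energy $e$ (solutions $\mathbb R\to\mathbb R^2\setminus\{0\}$ of the Euler–Lagrange equation of $L(x,v)=\frac12 g_x(v,v)-V_{\mathrm{Kep}}(x)$) are periodic and all of them, traversed over their least period, have the same length with respect to the Jacobi–Maupertuis metric $2(e-V_{\mathrm{Kep}})g$. Let $\mathcal Z$ be the set of rotationally invariant metrics $g$ such that $(g,V_{\mathrm{Kep}})$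 is Zoll on $\{H=-h_i/2\}$ for every $i=1,\dots,n$, where two metrics are identified (equivalent) if they agree on the union $\{0<|x|\le 2/h_n\}$ of the Hill's regions of these levels. A family $c:\mathbb R^N\to\mathcal Z$ is called smooth and nondegenerate if it is represented by metrics $g_t$ that depend smoothly on $(t,x)\in\mathbb R^N\times\mathbb R^2$ and such that, for every $t$ and every nonzero $u\in\mathbb R^N$, the derivative of $g_t$ at $t$ in the direction $u$ does not vanish identically on $\{0<|x|\le 2/h_n\}$. Then the set of positive numbers of the form $\sum_i a_i\xi_i$ with $a_i\in\mathbb Z$ has a least element $\gamma>0$; the space $\mathcal Z$ is infinite dimensional, that is, for every $N\in\mathbb N$ there is an injective smooth nondegenerate family $\mathbb R^N\to\mathcal Z$; and $\mathcal Z$ contains a subset $S$ in bijection with the space $C_c^\infty(0,\gamma)$ of smooth real functions with compact support in $(0,\gamma)$. Moreover, the bijection $C_c^\infty(0,\gamma)\to S$ can be chosen so that its composition with every injective linear map $\mathbb R^N\to C_c^\infty(0,\gamma)$, $N\in\mathbb N$, is a smooth nondegenerate family. -/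

import Mathlib

open scoped ContDiff Distributions

noncomputable section

/-- The plane `ℝ²` with its Euclidean structure. -/
abbrev Plane : Type := EuclideanSpace ℝ (Fin 2)

/-- A smooth Riemannian metric on the whole plane (the origin included), given as a field of
symmetric positive definite bilinear forms. -/
structure PlaneMetric where
  /-- the scalar product at a point -/
  form : Plane → Plane →L[ℝ] Plane →L[ℝ] ℝ
  smooth : ContDiff ℝ ∞ form
  symm : ∀ q v w, form q v w = form q w v
  pos : ∀ q v, v ≠ 0 → 0 < form q v v

/-- Rotational invariance about the origin: every linear isometry of the Euclidean plane is an
isometry of `g`. Away from the origin such a metric has the form `a(ρ)² dρ² + b(ρ)² dθ²` in polar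
coordinates (reflections exclude a mixed term `dρ dθ`). -/
def PlaneMetric.RotInvariant (g : PlaneMetric) : Prop :=
  ∀ (U : Plane ≃ₗᵢ[ℝ] Plane) (q v w : Plane), g.form (U q) (U v) (U w) = g.form q v w

/-- The Kepler potential `-1/|q|` (used only for `q ≠ 0`). -/
def keplerPotential (q : Plane) : ℝ := -(1 / ‖q‖)

/-- The natural Lagrangian `L(q, v) = ½ g_q(v, v) - V(q)`. -/
def natLagrangian (g : PlaneMetric) (V : Plane → ℝ) (q v : Plane) : ℝ :=
  1 / 2 * g.form q v v - V q

/-- The energy `H(q, v) = ½ g_q(v, v) + V(q)`. -/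
def natEnergy (g : PlaneMetric) (V : Plane → ℝ) (q v : Plane) : ℝ :=
  1 / 2 * g.form q v v + V q

/-- A non-collision orbit of the system `(g, V)` on the punctured plane: a solution, defined for
all times, of the Euler-Lagrange equation `d/dt ∂L/∂v (x, x') = ∂L/∂q (x, x')` that never meets the
origin. (On a level on which the motion is confined to a bounded region, a maximal solution that is
not defined for all times runs into the origin, so it is a collision orbit.) -/
structure IsNonCollisionOrbit (g : PlaneMetric) (V : Plane → ℝ) (x : ℝ → Plane) : Prop where
  contDiff : ContDiff ℝ 2 x
  ne_zero : ∀ t, x t ≠ 0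
  euler_lagrange : ∀ t,
    HasDerivAt (fun s => fderiv ℝ (fun v => natLagrangian g V (x s) v) (deriv x s))
      (fderiv ℝ (fun q => natLagrangian g V q (deriv x t)) (x t)) t

/-- The Jacobi-Maupertuis (semi-)metric `2 (e - V) g` of the energy `e`. -/
def jacobiMetric (g : PlaneMetric) (V : Plane → ℝ) (e : ℝ) (q : Plane) : Plane →L[ℝ] Plane →L[ℝ] ℝ :=
  (2 * (e - V q)) • g.form q

/-- Length of the arc `x|_[0,T]` with respect to the Jacobi-Maupertuis metric. -/
def jacobiLength (g : PlaneMetric) (V : Plane → ℝ) (e : ℝ) (x : ℝ → Plane) (T : ℝ) : ℝ :=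
  ∫ t in (0 : ℝ)..T, Real.sqrt (jacobiMetric g V e (x t) (deriv x t) (deriv x t))

/-- The system `(g, V)` is Zoll on the level `{H = e}`: all non-collision orbits of energy `e`
are closed, and they all have the same (Jacobi-Maupertuis) length `l`, measured over the least
period. -/
def IsZollAt (g : PlaneMetric) (V : Plane → ℝ) (e : ℝ) : Prop :=
  ∃ l : ℝ, 0 < l ∧ ∀ x : ℝ → Plane, IsNonCollisionOrbit g V x →
    (∀ t, natEnergy g V (x t) (deriv x t) = e) →
    ∃ T : ℝ, IsLeast {T : ℝ | 0 < T ∧ Function.Periodic x T} T ∧ jacobiLength g V e x T = l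

/-- Hill's region of the level `{H = e}`: the projection of the level to the punctured plane. -/
def hillRegion (V : Plane → ℝ) (e : ℝ) : Set Plane := {q | q ≠ 0 ∧ V q ≤ e}

section Levels

variable {n : ℕ}

/-- The rotationally invariant metrics `g` on the plane such that `(g, V_Kep)` is Zoll on all the
levels `{H = -hᵢ/2}`. -/
def ZollMetric (h : Fin (n + 1) → ℝ) : Type :=
  {g : PlaneMetric // g.RotInvariant ∧ ∀ i, IsZollAt g keplerPotential (-(h i) / 2)}

/-- The region swept out by the orbits under consideration: the union of the Hill's regions
of the levels `{H = -hᵢ/2}` of the Kepler potential. -/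
def totalHillRegion (h : Fin (n + 1) → ℝ) : Set Plane :=
  ⋃ i, hillRegion keplerPotential (-(h i) / 2)

/-- Two metrics are equivalent if they agree on Hill's region. -/
def zollSetoid (h : Fin (n + 1) → ℝ) : Setoid (ZollMetric h) where
  r g g' := ∀ q ∈ totalHillRegion h, g.1.form q = g'.1.form q
  iseqv :=
    { refl := fun _ _ _ => rfl
      symm := fun H q hq => (H q hq).symm
      trans := fun H H' q hq => (H q hq).trans (H' q hq) }

/-- The space of non-equivalent metrics: equivalence classes of metrics in `ZollMetric h`. -/
def ZollSpace (h : Fin (n + 1) → ℝ) : Type := Quotient (zollSetoid h)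

/-- A smooth nondegenerate `N`-parameter family in `ZollSpace h`: it is represented by metrics
`g_t` that depend smoothly on `(t, q)` jointly, and for every `t` the derivative of `g_t` in any
nonzero parameter direction does not vanish identically on Hill's region. -/
def IsSmoothNondegFamily (h : Fin (n + 1) → ℝ) {N : ℕ}
    (c : EuclideanSpace ℝ (Fin N) → ZollSpace h) : Prop :=
  ∃ G : EuclideanSpace ℝ (Fin N) → ZollMetric h,
    (∀ t, Quotient.mk (zollSetoid h) (G t) = c t) ∧
    ContDiff ℝ ∞ (fun p : EuclideanSpace ℝ (Fin N) × Plane => (G p.1).1.form p.2) ∧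
    ∀ t u : EuclideanSpace ℝ (Fin N), u ≠ 0 →
      ∃ q ∈ totalHillRegion h, fderiv ℝ (fun s => (G s).1.form q) t u ≠ 0

/-- `ZollSpace h` is infinite dimensional: for every `N` it contains an injective smooth
nondegenerate family with `N` parameters. -/
def ZollSpaceInfiniteDimensional (h : Fin (n + 1) → ℝ) : Prop :=
  ∀ N : ℕ, ∃ c : EuclideanSpace ℝ (Fin N) → ZollSpace h,
    Function.Injective c ∧ IsSmoothNondegFamily h c

/-- The numbers `ξᵢ = h₁/hᵢ - 1` (the index `0` is the first one, so `ξ 0 = 0` if `h 0 ≠ 0`). -/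
def xi (h : Fin (n + 1) → ℝ) (i : Fin (n + 1)) : ℝ := h 0 / h i - 1

/-- The positive integer combinations of the `ξᵢ`. -/
def posCombinations (h : Fin (n + 1) → ℝ) : Set ℝ :=
  {s | 0 < s ∧ ∃ a : Fin (n + 1) → ℤ, s = ∑ i, (a i : ℝ) * xi h i}

/-- The infimum of the positive integer combinations of the `ξᵢ`. -/
def gammaInf (h : Fin (n + 1) → ℝ) : ℝ := sInf (posCombinations h)

end Levels

/-- Two real numbers are rationally dependent. -/
def RatDependent (a b : ℝ) : Prop := ∃ p q : ℤ, (p ≠ 0 ∨ q ≠ 0) ∧ (p : ℝ) * a + (q : ℝ) * b = 0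

/-- The open interval `(0, c)` as an open subset of `ℝ`. -/
def openInterval (c : ℝ) : TopologicalSpace.Opens ℝ := ⟨Set.Ioo 0 c, isOpen_Ioo⟩

end

/-! The metrics used are `a(ρ)² dρ² + ρ² dθ²` with `a = 1 + ρ f(ρ)`. On the level `-h/2`, an
eccentric anomaly `E` with `dE/dt = √h / (a r)` removes `a` from the radial equation: as a function
of `E`, the radius is that of a Kepler ellipse, `R(E) = (1 - p cos E + q sin E)/h`
(`exists_anomaly`). The factor `a` survives only in the time, the angle and the length. In
particular `dθ/dE = J (1/R + f(R)) / √h`. Replacing `E` by `E + π` replaces `R` by `2/h - R`. If `f`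
is odd about `1/h`, then `f(R(E))` changes sign and its integral over a turn vanishes. What remains
is the Kepler integral, evaluated with the Poisson kernel, which gives an angle of exactly `2π`. The
same symmetry gives the length `2π/√h`. Hence oddness of `f` about `1/h`, with `a > 0`, implies the
Zoll property (`exists_isLeast_period`, `isZollAt_of_radialForm`).

For several levels, `f` has to be odd about every `1/hᵢ = (1 + ξᵢ)/h₁`. Rational dependence makes
every `ξᵢ` an integer multiple of the least positive combination `γ` (`isLeast_gammaInf`,
`xi_eq_mul_of_isLeast`). It therefore suffices that `f` is odd about `1/h₁` and has period `2γ/h₁`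
on the Hill's regions. Such functions are sines times arbitrary functions of a cosine, so a test
function `u` on `(0, γ)` can be inserted freely (`zollProfile`). Three precautions make this a
metric: `arctan` and a normalization keep `a` positive, a cutoff acts beyond all Hill's regions, and
`u` is read only through a window of cosine values missed near the origin, so the metric is
Euclidean there. Each value of `u` can be recovered from the metric at some radius inside the Hill's
regions. This gives injectivity and, since `arctan` has positive derivative, nondegeneracy
(`exists_zollMetric_embedding`). -/

/-! ### Integrals over a period -/

/-- A function with vanishing derivative takes the same value everywhere. -/
theorem eq_of_hasDerivAt_zero {f : ℝ → ℝ} (hf : ∀ t, HasDerivAt f 0 t) (s t : ℝ) : f s = f t :=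
  is_const_of_deriv_eq_zero (fun t => (hf t).differentiableAt) (fun t => (hf t).deriv) s t

/-- The integral of a function which is antiperiodic with antiperiod `π` over `[0, 2π]` vanishes. -/
theorem integral_eq_zero_of_antiperiodic {g : ℝ → ℝ} (hg : Function.Antiperiodic g Real.pi) :
    ∫ E in (0 : ℝ)..2 * Real.pi, g E = 0 := by
  have hper : Function.Periodic g (2 * Real.pi) := hg.periodic_two_mul
  have h1 := hper.intervalIntegral_add_eq Real.pi 0
  have h2 : ∫ E in (0 : ℝ)..2 * Real.pi, g (E + Real.pi) =
      ∫ E in (0 + Real.pi)..(2 * Real.pi + Real.pi), g E :=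
    intervalIntegral.integral_comp_add_right (fun E => g E) Real.pi
  have h3 : ∫ E in (0 : ℝ)..2 * Real.pi, g (E + Real.pi) = -∫ E in (0 : ℝ)..2 * Real.pi, g E := by
    rw [← intervalIntegral.integral_neg]
    exact intervalIntegral.integral_congr fun E _ => hg E
  have e1 : Real.pi + 2 * Real.pi = 2 * Real.pi + Real.pi := by ring
  rw [e1, zero_add] at h1
  rw [zero_add, h3, h1] at h2
  linarith

/-- The integral of the reciprocal of `1 - ε cos` over a period. -/
theorem integral_inv_one_sub_cos {p q σ : ℝ} (hσ : 0 < σ) (hpq : p ^ 2 + q ^ 2 = 1 - σ ^ 2) :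
    ∫ E in (0 : ℝ)..2 * Real.pi, (1 - (p * Real.cos E - q * Real.sin E))⁻¹ =
      2 * Real.pi / σ := by
  -- With this scaling `1 + |w|² = 2l`, so `|z - w|²` on the unit circle is `2l` times the given
  -- denominator. The integrand is then the Poisson kernel at `w` divided by `σ`, and the Poisson
  -- kernel has mean `1`.
  set l : ℝ := (1 + σ)⁻¹ with hl
  have hl0 : 0 < l := by positivity
  have hls : l * (1 + σ) = 1 := by rw [hl]; field_simp
  set w : ℂ := ⟨l * p, -(l * q)⟩ with hw
  have hwn : ‖w‖ ^ 2 = l ^ 2 * (1 - σ ^ 2) := by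
    rw [← Complex.normSq_eq_norm_sq, Complex.normSq_apply, hw, ← hpq]; ring
  have hwl : ‖w‖ ^ 2 = 2 * l - 1 := by
    rw [hwn]
    have : l ^ 2 * (1 - σ ^ 2) = (l * (1 + σ)) * (l * (2 - (1 + σ))) := by ring
    rw [this, hls]; linarith [hls, mul_add l 1 σ]
  have hw1 : ‖w‖ < 1 := by
    have : l < 1 := by nlinarith
    nlinarith [norm_nonneg w]
  have hball : w ∈ Metric.ball (0 : ℂ) 1 := by simpa using hw1
  have key := DiffContOnCl.circleAverage_poissonKernel_smul
    (f := fun _ : ℂ => (1 : ℂ)) (R := 1) (c := 0) diffContOnCl_const hball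
  have hre := congrArg Complex.re key
  rw [Real.circleAverage_def] at hre
  have hint : ∀ E : ℝ, (poissonKernel 0 w • fun _ : ℂ => (1 : ℂ)) (circleMap 0 1 E) =
      ((σ * (1 - (p * Real.cos E - q * Real.sin E))⁻¹ : ℝ) : ℂ) := by
    intro E
    have hz : circleMap 0 1 E = ⟨Real.cos E, Real.sin E⟩ := by
      apply Complex.ext <;> simp [circleMap, Complex.exp_re, Complex.exp_im]
    have hn1 : ‖circleMap 0 1 E‖ ^ 2 = 1 := by simp
    have hn2 : ‖circleMap 0 1 E - w‖ ^ 2 = 2 * l * (1 - (p * Real.cos E - q * Real.sin E)) := by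
      have e1 : ‖circleMap 0 1 E - w‖ ^ 2 = ‖circleMap 0 1 E‖ ^ 2 + ‖w‖ ^ 2
          - 2 * (l * (p * Real.cos E - q * Real.sin E)) := by
        rw [← Complex.normSq_eq_norm_sq, ← Complex.normSq_eq_norm_sq, ← Complex.normSq_eq_norm_sq,
          hz, hw, Complex.normSq_apply, Complex.normSq_apply, Complex.normSq_apply]
        simp only [Complex.sub_re, Complex.sub_im]
        ring
      rw [e1, hn1, hwl]; ring
    have hp : poissonKernel 0 w (circleMap 0 1 E) =
        σ * (1 - (p * Real.cos E - q * Real.sin E))⁻¹ := by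
      rw [poissonKernel_def, sub_zero, sub_zero, hn1, hn2, hwl,
        show 1 - (2 * l - 1) = 2 * l * σ by linarith [mul_add l 1 σ], mul_div_mul_left _ _ (by positivity),
        div_eq_mul_inv]
    rw [Pi.smul_apply', hp]
    simp
  simp_rw [hint] at hre
  rw [intervalIntegral.integral_ofReal, intervalIntegral.integral_const_mul] at hre
  have hpi := Real.pi_pos
  rw [Complex.real_smul, ← Complex.ofReal_mul, Complex.ofReal_re, Complex.one_re] at hre
  field_simp at hre ⊢
  linarith

/-! ### The eccentric anomaly and the radial motion -/

/-- The radial profile `ρ(E) = (1 - (p cos E - q sin E)) / h` of a Kepler ellipse as a function of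
the eccentric anomaly. -/
noncomputable def anomalyRadius (h p q E : ℝ) : ℝ := (1 - (p * Real.cos E - q * Real.sin E)) / h

section Anomaly

variable {h p q : ℝ}

theorem continuous_anomalyRadius : Continuous (anomalyRadius h p q) := by
  unfold anomalyRadius; fun_prop

theorem anomalyRadius_periodic : Function.Periodic (anomalyRadius h p q) (2 * Real.pi) := by
  intro E; simp [anomalyRadius]

/-- Half a turn flips the sign of cosine and sine. This reflection about `1/h` is what turns oddness
of `f` into antiperiodicity in the anomaly. -/
theorem anomalyRadius_add_pi (hh : 0 < h) (E : ℝ) :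
    anomalyRadius h p q (E + Real.pi) = 2 / h - anomalyRadius h p q E := by
  simp only [anomalyRadius, Real.cos_add_pi, Real.sin_add_pi]
  field_simp
  ring

theorem anomalyRadius_mem (hh : 0 < h) (hpq : p ^ 2 + q ^ 2 < 1) (E : ℝ) :
    anomalyRadius h p q E ∈ Set.Ioo 0 (2 / h) := by
  have h1 : (p * Real.cos E - q * Real.sin E) ^ 2 < 1 := by
    have : (p * Real.cos E - q * Real.sin E) ^ 2 + (p * Real.sin E + q * Real.cos E) ^ 2 =
        (p ^ 2 + q ^ 2) * (Real.cos E ^ 2 + Real.sin E ^ 2) := by ring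
    rw [Real.cos_sq_add_sin_sq, mul_one] at this
    nlinarith [sq_nonneg (p * Real.sin E + q * Real.cos E)]
  rw [sq_lt_one_iff_abs_lt_one, abs_lt] at h1
  refine ⟨div_pos (by linarith) hh, ?_⟩
  unfold anomalyRadius
  gcongr
  linarith

theorem integral_inv_anomalyRadius {σ : ℝ} (hσ : 0 < σ) (hpq : p ^ 2 + q ^ 2 = 1 - σ ^ 2) :
    ∫ E in (0 : ℝ)..2 * Real.pi, (anomalyRadius h p q E)⁻¹ = h * (2 * Real.pi / σ) := by
  rw [← integral_inv_one_sub_cos hσ hpq, ← intervalIntegral.integral_const_mul]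
  congr 1; ext E
  rw [anomalyRadius, inv_div, div_eq_mul_inv]

end Anomaly

/-- Along a solution, the eccentric anomaly `E` uniformizes the radial motion. -/
theorem exists_anomaly {h J : ℝ} (hh : 0 < h) {a : ℝ → ℝ} (r m : ℝ → ℝ) (hr : ∀ t, 0 < r t)
    (ha : ∀ t, 0 < a (r t)) (hcont : Continuous fun t => a (r t))
    (hr' : ∀ t, HasDerivAt r (m t / r t) t)
    (hm : ∀ t, HasDerivAt (fun s => a (r s) * m s) ((1 / r t - h) / a (r t)) t)
    (he : ∀ t, (a (r t) * m t) ^ 2 + J ^ 2 = 2 * r t - h * r t ^ 2) :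
    ∃ (E : ℝ → ℝ) (p q : ℝ), E 0 = 0 ∧
      (∀ t, HasDerivAt E (Real.sqrt h / (a (r t) * r t)) t) ∧
      (∀ t, r t = anomalyRadius h p q (E t)) ∧ p ^ 2 + q ^ 2 = 1 - h * J ^ 2 := by
  have hrc : Continuous r := continuous_iff_continuousAt.2 fun t => (hr' t).continuousAt
  have hkc : Continuous fun t => Real.sqrt h / (a (r t) * r t) :=
    continuous_const.div (hcont.mul hrc) fun t => (mul_pos (ha t) (hr t)).ne'
  set E : ℝ → ℝ := fun t => ∫ s in (0 : ℝ)..t, Real.sqrt h / (a (r s) * r s) with hE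
  have hE' : ∀ t, HasDerivAt E (Real.sqrt h / (a (r t) * r t)) t := fun t =>
    (hkc.integral_hasStrictDerivAt 0 t).hasDerivAt
  have hE0 : E 0 = 0 := by simp [hE]
  have hs : Real.sqrt h ^ 2 = h := Real.sq_sqrt hh.le
  have hs0 : 0 < Real.sqrt h := Real.sqrt_pos.2 hh
  -- With respect to `E` the pair `(w, z)` satisfies `dw/dE = -z`, `dz/dE = w`. Rotating it back by
  -- the angle `E` therefore gives the two constants `c1` and `c2`.
  set w : ℝ → ℝ := fun t => 1 - h * r t with hw
  set z : ℝ → ℝ := fun t => Real.sqrt h * (a (r t) * m t) with hz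
  have hw' : ∀ t, HasDerivAt w (-(Real.sqrt h / (a (r t) * r t)) * z t) t := fun t => by
    have := ((hr' t).const_mul h).const_sub 1
    refine this.congr_deriv ?_
    have h1 := (ha t).ne'; have h2 := (hr t).ne'
    simp only [hz]
    field_simp
    rw [hs]
    ring
  have hz' : ∀ t, HasDerivAt z (Real.sqrt h / (a (r t) * r t) * w t) t := fun t => by
    have := (hm t).const_mul (Real.sqrt h)
    refine this.congr_deriv ?_
    have h1 := (ha t).ne'; have h2 := (hr t).ne'
    simp only [hw]
    field_simp
  have c1 : ∀ t, w t * Real.cos (E t) + z t * Real.sin (E t) = w 0 := fun t => by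
    have := eq_of_hasDerivAt_zero
      (f := fun t => w t * Real.cos (E t) + z t * Real.sin (E t)) (fun t => by
        refine (((hw' t).mul (hE' t).cos).add ((hz' t).mul (hE' t).sin)).congr_deriv (by ring)) t 0
    simpa [hE0] using this
  have c2 : ∀ t, z t * Real.cos (E t) - w t * Real.sin (E t) = z 0 := fun t => by
    have := eq_of_hasDerivAt_zero
      (f := fun t => z t * Real.cos (E t) - w t * Real.sin (E t)) (fun t => by
        refine (((hz' t).mul (hE' t).cos).sub ((hw' t).mul (hE' t).sin)).congr_deriv (by ring)) t 0
    simpa [hE0] using this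
  refine ⟨E, w 0, z 0, hE0, hE', fun t => ?_, ?_⟩
  · have hcs := Real.cos_sq_add_sin_sq (E t)
    have : w 0 * Real.cos (E t) - z 0 * Real.sin (E t) = w t := by
      rw [← c1 t, ← c2 t]; linear_combination w t * hcs
    rw [anomalyRadius, this, hw]
    field_simp
    ring
  · simp only [hw, hz]
    have := he 0
    linear_combination h * this + (a (r 0) * m 0) ^ 2 * hs

/-- Solutions which exist for all times and avoid the origin have nonzero angular momentum. -/
theorem angular_momentum_ne_zero {h J : ℝ} (hh : 0 < h) {a : ℝ → ℝ} {r E : ℝ → ℝ} {p q C : ℝ}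
    (hr : ∀ t, 0 < r t) (ha : ∀ t, 0 < a (r t)) (hC : ∀ t, a (r t) * r t ≤ C)
    (hE0 : E 0 = 0) (hE' : ∀ t, HasDerivAt E (Real.sqrt h / (a (r t) * r t)) t)
    (hrE : ∀ t, r t = anomalyRadius h p q (E t)) (hpq : p ^ 2 + q ^ 2 = 1 - h * J ^ 2) :
    J ≠ 0 := by
  rintro rfl
  have hs0 : 0 < Real.sqrt h := Real.sqrt_pos.2 hh
  have hC0 : 0 < C := (mul_pos (ha 0) (hr 0)).trans_le (hC 0)
  -- If `J = 0`, then `p² + q² = 1` and the radius vanishes at some anomaly `φ`, made nonnegative by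
  -- adding `2π` to an argument. Since `E` grows at a rate of at least `√h / C`, it reaches `φ` in
  -- finite time, which is a collision.
  obtain ⟨φ, hφ⟩ : ∃ φ : ℝ, 0 ≤ φ ∧ p * Real.cos φ - q * Real.sin φ = 1 := by
    have hn : ‖(⟨p, -q⟩ : ℂ)‖ = 1 := by
      have : ‖(⟨p, -q⟩ : ℂ)‖ ^ 2 = 1 := by
        rw [← Complex.normSq_eq_norm_sq, Complex.normSq_apply]; linear_combination hpq
      have h0 := norm_nonneg (⟨p, -q⟩ : ℂ)
      nlinarith
    have hc := Complex.norm_mul_cos_arg (⟨p, -q⟩ : ℂ)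
    have hs := Complex.norm_mul_sin_arg (⟨p, -q⟩ : ℂ)
    rw [hn, one_mul] at hc hs
    refine ⟨Complex.arg ⟨p, -q⟩ + 2 * Real.pi, ?_, ?_⟩
    · have := Complex.neg_pi_lt_arg (⟨p, -q⟩ : ℂ)
      linarith [Real.pi_pos]
    · rw [Real.cos_add_two_pi, Real.sin_add_two_pi, hc, hs]
      simp only
      linear_combination hpq
  have hdiff : Differentiable ℝ E := fun t => (hE' t).differentiableAt
  have hgrow : ∀ t, 0 ≤ t → Real.sqrt h / C * t ≤ E t := fun t ht => by
    have := mul_sub_le_image_sub_of_le_deriv hdiff (C := Real.sqrt h / C) (fun s => by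
      rw [(hE' s).deriv]
      have := mul_pos (ha s) (hr s)
      have := hC s
      gcongr) ht
    simpa [hE0] using this
  obtain ⟨t, -, ht⟩ := intermediate_value_Icc (a := 0) (b := C / Real.sqrt h * φ)
    (mul_nonneg (by positivity) hφ.1) hdiff.continuous.continuousOn
    (show φ ∈ Set.Icc (E 0) (E (C / Real.sqrt h * φ)) from ⟨hE0.le.trans hφ.1, by
      have := hgrow (C / Real.sqrt h * φ) (mul_nonneg (by positivity) hφ.1)
      calc φ = Real.sqrt h / C * (C / Real.sqrt h * φ) := by field_simp
        _ ≤ _ := this⟩)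
  have := hrE t
  rw [anomalyRadius, ht, hφ.2, sub_self, zero_div] at this
  exact (hr t).ne' this

/-! ### Closing of the orbits -/

theorem hasDerivAt_integral {g : ℝ → ℝ} (hg : Continuous g) (E : ℝ) :
    HasDerivAt (fun u => ∫ s in (0 : ℝ)..u, g s) (g E) E :=
  (hg.integral_hasStrictDerivAt 0 E).hasDerivAt

theorem integral_zero_add_period {g : ℝ → ℝ} (hg : Continuous g) {P : ℝ}
    (hper : Function.Periodic g P) (E : ℝ) :
    ∫ s in (0 : ℝ)..E + P, g s = (∫ s in (0 : ℝ)..E, g s) + ∫ s in (0 : ℝ)..P, g s := by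
  have h1 := hper.intervalIntegral_add_eq E 0
  rw [zero_add] at h1
  rw [← h1]
  exact (intervalIntegral.integral_add_adjacent_intervals (hg.intervalIntegrable _ _)
    (hg.intervalIntegrable _ _)).symm

theorem strictMono_integral {g : ℝ → ℝ} (hg : Continuous g) (hpos : ∀ s, 0 < g s) :
    StrictMono fun u => ∫ s in (0 : ℝ)..u, g s :=
  strictMono_of_hasDerivAt_pos (fun E => hasDerivAt_integral hg E) hpos

/-- Motion in polar coordinates: if `θ' = J / r²`, then the position at time `t` is obtained from
the initial position by rotating by `θ t - θ 0` and rescaling. -/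
theorem polar_position {x y vx vy r θ : ℝ → ℝ} {J : ℝ}
    (hx : ∀ t, HasDerivAt x (vx t) t) (hy : ∀ t, HasDerivAt y (vy t) t)
    (hr : ∀ t, 0 < r t) (hr2 : ∀ t, r t ^ 2 = x t ^ 2 + y t ^ 2)
    (hr' : ∀ t, HasDerivAt r ((x t * vx t + y t * vy t) / r t) t)
    (hJ : ∀ t, x t * vy t - y t * vx t = J)
    (hθ0 : θ 0 = 0) (hθ : ∀ t, HasDerivAt θ (J / r t ^ 2) t) (t : ℝ) :
    x t = r t / r 0 * (x 0 * Real.cos (θ t) - y 0 * Real.sin (θ t)) ∧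
    y t = r t / r 0 * (y 0 * Real.cos (θ t) + x 0 * Real.sin (θ t)) := by
  -- `c1` and `c2` say that the unit vector `(x, y) / r`, rotated back by `θ`, is constant.
  have c1 : (x t * Real.cos (θ t) + y t * Real.sin (θ t)) / r t = x 0 / r 0 := by
    have := eq_of_hasDerivAt_zero
      (f := fun t => (x t * Real.cos (θ t) + y t * Real.sin (θ t)) / r t) (fun t => by
        refine ((((hx t).mul (hθ t).cos).add ((hy t).mul (hθ t).sin)).div (hr' t)
          (hr t).ne').congr_deriv ?_
        have h1 := (hr t).ne'
        simp only [Pi.add_apply, Pi.mul_apply]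
        field_simp
        linear_combination (vx t * Real.cos (θ t) + vy t * Real.sin (θ t)) * hr2 t
          + (x t * Real.sin (θ t) - y t * Real.cos (θ t)) * hJ t) t 0
    simpa [hθ0] using this
  have c2 : (y t * Real.cos (θ t) - x t * Real.sin (θ t)) / r t = y 0 / r 0 := by
    have := eq_of_hasDerivAt_zero
      (f := fun t => (y t * Real.cos (θ t) - x t * Real.sin (θ t)) / r t) (fun t => by
        refine ((((hy t).mul (hθ t).cos).sub ((hx t).mul (hθ t).sin)).div (hr' t)
          (hr t).ne').congr_deriv ?_
        have h1 := (hr t).ne'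
        simp only [Pi.sub_apply, Pi.mul_apply]
        field_simp
        linear_combination (vy t * Real.cos (θ t) - vx t * Real.sin (θ t)) * hr2 t
          + (x t * Real.cos (θ t) + y t * Real.sin (θ t)) * hJ t) t 0
    simpa [hθ0] using this
  have h1 := (hr t).ne'; have h0 := (hr 0).ne'
  have hcs := Real.cos_sq_add_sin_sq (θ t)
  rw [div_eq_div_iff h1 h0] at c1 c2
  constructor
  · field_simp
    linear_combination Real.cos (θ t) * c1 - Real.sin (θ t) * c2 - x t * r 0 * hcs
  · field_simp
    linear_combination Real.sin (θ t) * c1 + Real.cos (θ t) * c2 - y t * r 0 * hcs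

/-- Radial factors `a(ρ) = 1 + ρ f(ρ)` with `f` odd about `1/h` make all orbits of energy `-h/2`
closed, with the same length as for the Euclidean Kepler problem. -/
theorem exists_isLeast_period {h J : ℝ} (hh : 0 < h) {f : ℝ → ℝ} (hf : Continuous f)
    (hodd : ∀ ρ ∈ Set.Ioo 0 (2 / h), f (2 / h - ρ) = -f ρ)
    (hpos : ∀ ρ, 0 < ρ → 0 < 1 + ρ * f ρ)
    {x y vx vy r : ℝ → ℝ}
    (hx : ∀ t, HasDerivAt x (vx t) t) (hy : ∀ t, HasDerivAt y (vy t) t)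
    (hr : ∀ t, 0 < r t) (hr2 : ∀ t, r t ^ 2 = x t ^ 2 + y t ^ 2)
    (hr' : ∀ t, HasDerivAt r ((x t * vx t + y t * vy t) / r t) t)
    (hJ : ∀ t, x t * vy t - y t * vx t = J)
    (hm : ∀ t, HasDerivAt (fun s => (1 + r s * f (r s)) * (x s * vx s + y s * vy s))
      ((1 / r t - h) / (1 + r t * f (r t))) t)
    (he : ∀ t, ((1 + r t * f (r t)) * (x t * vx t + y t * vy t)) ^ 2 + J ^ 2 =
      2 * r t - h * r t ^ 2) :
    ∃ T, IsLeast {T | 0 < T ∧ Function.Periodic x T ∧ Function.Periodic y T} T ∧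
      ∫ t in (0 : ℝ)..T, (2 / r t - h) = 2 * Real.pi / Real.sqrt h := by
  have hs0 : 0 < Real.sqrt h := Real.sqrt_pos.2 hh
  have hs2 : Real.sqrt h * Real.sqrt h = h := Real.mul_self_sqrt hh.le
  have hpi := Real.pi_pos
  have hrc : Continuous r := continuous_iff_continuousAt.2 fun t => (hr' t).continuousAt
  have ha : ∀ t, 0 < 1 + r t * f (r t) := fun t => hpos _ (hr t)
  have hac : Continuous fun ρ : ℝ => 1 + ρ * f ρ := by fun_prop
  have hrle : ∀ t, r t ≤ 2 / h := fun t => by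
    rw [le_div_iff₀ hh]
    have : 0 ≤ r t * (2 - r t * h) := by
      have := he t
      nlinarith [sq_nonneg ((1 + r t * f (r t)) * (x t * vx t + y t * vy t)), sq_nonneg J]
    nlinarith [nonneg_of_mul_nonneg_right this (hr t)]
  obtain ⟨C, hC⟩ : ∃ C, ∀ t, (1 + r t * f (r t)) * r t ≤ C := by
    obtain ⟨C, hC⟩ := (isCompact_Icc (a := (0 : ℝ)) (b := 2 / h)).bddAbove_image
      (hac.mul continuous_id).continuousOn
    exact ⟨C, fun t => hC ⟨r t, ⟨(hr t).le, hrle t⟩, rfl⟩⟩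
  obtain ⟨E, p, q, hE0, hE', hrE, hpq⟩ := exists_anomaly (a := fun ρ => 1 + ρ * f ρ) hh r
    (fun t => x t * vx t + y t * vy t) hr ha (hac.comp hrc) hr' hm he
  have hJ0 : J ≠ 0 := angular_momentum_ne_zero (a := fun ρ => 1 + ρ * f ρ) hh hr ha hC hE0 hE' hrE hpq
  have hσ : 0 < Real.sqrt h * |J| := mul_pos hs0 (abs_pos.2 hJ0)
  have hpq' : p ^ 2 + q ^ 2 = 1 - (Real.sqrt h * |J|) ^ 2 := by
    rw [hpq, mul_pow, sq_abs, Real.sq_sqrt hh.le]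
  have hlt : p ^ 2 + q ^ 2 < 1 := by rw [hpq']; nlinarith
  set R : ℝ → ℝ := anomalyRadius h p q with hR
  have hRc : Continuous R := continuous_anomalyRadius
  have hRmem : ∀ u, R u ∈ Set.Ioo 0 (2 / h) := anomalyRadius_mem hh hlt
  have hR0 : ∀ u, 0 < R u := fun u => (hRmem u).1
  have hRper : Function.Periodic R (2 * Real.pi) := anomalyRadius_periodic
  have hRpi : ∀ u, R (u + Real.pi) = 2 / h - R u := anomalyRadius_add_pi hh
  set A : ℝ → ℝ := fun u => 1 + R u * f (R u) with hA
  have hApos : ∀ u, 0 < A u := fun u => hpos _ (hR0 u)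
  have hAc : Continuous A := hac.comp hRc
  have hAper : Function.Periodic A (2 * Real.pi) := fun u => by simp only [hA, hRper u]
  have hrA : ∀ t, 1 + r t * f (r t) = A (E t) := fun t => by rw [hA, hrE t]
  -- time, angle and length as functions of the eccentric anomaly
  set τ : ℝ → ℝ := fun u => A u * R u / Real.sqrt h with hτ
  set g : ℝ → ℝ := fun u => A u / (Real.sqrt h * R u) with hg
  set l : ℝ → ℝ := fun u => (2 - h * R u) * A u / Real.sqrt h with hl
  have hτc : Continuous τ := (hAc.mul hRc).div_const _
  have hgc : Continuous g := hAc.div (continuous_const.mul hRc) fun u =>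
    (mul_pos hs0 (hR0 u)).ne'
  have hlc : Continuous l := ((continuous_const.sub (continuous_const.mul hRc)).mul hAc).div_const _
  have hτper : Function.Periodic τ (2 * Real.pi) := fun u => by simp only [hτ, hRper u, hAper u]
  have hgper : Function.Periodic g (2 * Real.pi) := fun u => by simp only [hg, hRper u, hAper u]
  have hτmono := strictMono_integral hτc fun u => div_pos (mul_pos (hApos u) (hR0 u)) hs0
  have hgmono := strictMono_integral hgc fun u => div_pos (hApos u) (mul_pos hs0 (hR0 u))
  -- The only place where oddness enters the angle: the perturbation contributes nothing over a full
  -- turn.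
  have hfanti : Function.Antiperiodic (fun u => f (R u)) Real.pi := fun u => by
    simp only [hRpi u, hodd _ (hRmem u)]
  have hg2pi : ∫ u in (0 : ℝ)..2 * Real.pi, g u = 2 * Real.pi / |J| := by
    have e : g = fun u => (Real.sqrt h)⁻¹ * ((R u)⁻¹ + f (R u)) := by
      ext u
      have := (hR0 u).ne'
      simp only [hg, hA]
      field_simp
    have i1 : Continuous fun u => (R u)⁻¹ := hRc.inv₀ fun u => (hR0 u).ne'
    have i2 : Continuous fun u => f (R u) := hf.comp hRc
    rw [e, intervalIntegral.integral_const_mul, intervalIntegral.integral_add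
      (i1.intervalIntegrable _ _) (i2.intervalIntegrable _ _), integral_eq_zero_of_antiperiodic hfanti,
      integral_inv_anomalyRadius hσ hpq', ← hs2]
    have := abs_pos.2 hJ0
    field_simp
    simp
  have hl2pi : ∫ u in (0 : ℝ)..2 * Real.pi, l u = 2 * Real.pi / Real.sqrt h := by
    have e : l = fun u => (Real.sqrt h)⁻¹ *
        (1 + ((1 - h * R u) + (2 - h * R u) * (R u * f (R u)))) := by
      ext u
      simp only [hl, hA]
      field_simp
      ring
    -- The factor `(2 - h R) R` is invariant under `R ↦ 2/h - R`, while `1 - h R` and `f(R)` change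
    -- sign.
    have hanti : Function.Antiperiodic
        (fun u => (1 - h * R u) + (2 - h * R u) * (R u * f (R u))) Real.pi := fun u => by
      simp only [hRpi u, hodd _ (hRmem u)]
      field_simp
      ring
    rw [e, intervalIntegral.integral_const_mul, intervalIntegral.integral_add
      (continuous_const.intervalIntegrable _ _)
      (Continuous.intervalIntegrable (by fun_prop) _ _), integral_eq_zero_of_antiperiodic hanti]
    simp
    field_simp
  -- Time as a function of the anomaly inverts `E`; a full turn of `E` thus takes the time `T`,
  -- whatever the starting point.
  have hτE : ∀ t, ∫ u in (0 : ℝ)..E t, τ u = t := fun t => by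
    have := eq_of_hasDerivAt_zero (f := fun t => (∫ u in (0 : ℝ)..E t, τ u) - t) (fun t => by
      refine (((hasDerivAt_integral hτc (E t)).comp t (hE' t)).sub (hasDerivAt_id t)).congr_deriv ?_
      have h1 := (hApos (E t)).ne'
      have h2 := (hr t).ne'
      simp only [hτ, ← hrE t, hrA t]
      field_simp
      simp) t 0
    simpa [hE0, sub_eq_zero] using this
  set T : ℝ := ∫ u in (0 : ℝ)..2 * Real.pi, τ u with hT
  have hET : ∀ t, E (t + T) = E t + 2 * Real.pi := fun t => by
    apply hτmono.injective
    simp only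
    rw [hτE, integral_zero_add_period hτc hτper, hτE]
  have hET0 : E T = 2 * Real.pi := by simpa [hE0] using hET 0
  set θ : ℝ → ℝ := fun t => J * ∫ u in (0 : ℝ)..E t, g u with hθ
  have hθ0 : θ 0 = 0 := by simp [hθ, hE0]
  have hθ' : ∀ t, HasDerivAt θ (J / r t ^ 2) t := fun t => by
    refine (((hasDerivAt_integral hgc (E t)).comp t (hE' t)).const_mul J).congr_deriv ?_
    have h1 := (hApos (E t)).ne'
    have h2 := (hr t).ne'
    simp only [hg, ← hrE t, hrA t]
    field_simp
  have hpolar := polar_position hx hy hr hr2 hr' hJ hθ0 hθ'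
  have hT0 : 0 < T := by
    have := hτmono (show (0 : ℝ) < 2 * Real.pi by positivity)
    simpa using this
  have hrT : ∀ t, r (t + T) = r t := fun t => by rw [hrE, hrE t, hET, hRper]
  have hθT : ∀ t, θ (t + T) = θ t + J / |J| * (2 * Real.pi) := fun t => by
    simp only [hθ]
    rw [hET, integral_zero_add_period hgc hgper, hg2pi]
    ring
  have hcs : ∀ t, Real.cos (θ (t + T)) = Real.cos (θ t) ∧ Real.sin (θ (t + T)) = Real.sin (θ t) := by
    intro t
    rw [hθT]
    rcases lt_or_gt_of_ne hJ0 with hneg | hp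
    · rw [abs_of_neg hneg, div_neg, div_self hJ0, neg_one_mul, ← sub_eq_add_neg]
      exact ⟨Real.cos_sub_two_pi _, Real.sin_sub_two_pi _⟩
    · rw [abs_of_pos hp, div_self hJ0, one_mul]
      exact ⟨Real.cos_add_two_pi _, Real.sin_add_two_pi _⟩
  refine ⟨T, ⟨⟨hT0, fun t => ?_, fun t => ?_⟩, ?_⟩, ?_⟩
  · rw [(hpolar (t + T)).1, (hpolar t).1, hrT, (hcs t).1, (hcs t).2]
  · rw [(hpolar (t + T)).2, (hpolar t).2, hrT, (hcs t).1, (hcs t).2]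
  -- Minimality of `T`: a return to the initial position forces `θ S` to be a multiple of `2π`,
  -- nonzero because the angle is strictly monotone. At least the angle of one full turn has then
  -- been swept, so `E S ≥ 2π` and `S ≥ T`.
  · rintro S ⟨hS0, hSx, hSy⟩
    have hxS : x S = x 0 := by simpa using hSx 0
    have hyS : y S = y 0 := by simpa using hSy 0
    have hrS : r S = r 0 := by
      have : r S ^ 2 = r 0 ^ 2 := by rw [hr2, hr2, hxS, hyS]
      exact (pow_left_inj₀ (hr S).le (hr 0).le two_ne_zero).1 this
    have hcos : Real.cos (θ S) = 1 := by
      obtain ⟨e1, e2⟩ := hpolar S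
      rw [hrS, div_self (hr 0).ne', one_mul] at e1 e2
      rw [hxS] at e1
      rw [hyS] at e2
      have h2 := hr2 0
      have h3 : r 0 ^ 2 * Real.cos (θ S) = r 0 ^ 2 * 1 := by
        rw [h2]; linear_combination (-(x 0)) * e1 - y 0 * e2
      exact mul_left_cancel₀ (pow_ne_zero 2 (hr 0).ne') h3
    obtain ⟨k, hk⟩ := (Real.cos_eq_one_iff _).1 hcos
    have hES : 0 < E S := by
      apply hτmono.lt_iff_lt.1
      simp only [hτE]
      simpa using hS0
    have hgS : 0 < ∫ u in (0 : ℝ)..E S, g u := by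
      have := hgmono hES
      simpa using this
    have hk0 : k ≠ 0 := by
      rintro rfl
      simp only [Int.cast_zero, zero_mul, hθ] at hk
      exact (mul_ne_zero hJ0 hgS.ne') hk.symm
    have habs : 2 * Real.pi ≤ |J| * ∫ u in (0 : ℝ)..E S, g u := by
      have h1 : |θ S| = |J| * ∫ u in (0 : ℝ)..E S, g u := by
        simp only [hθ]; rw [abs_mul, abs_of_pos hgS]
      rw [← h1, ← hk, abs_mul, abs_of_pos (by positivity : 0 < 2 * Real.pi)]
      have : (1 : ℝ) ≤ |(k : ℝ)| := by exact_mod_cast Int.one_le_abs hk0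
      nlinarith
    have hgle : ∫ u in (0 : ℝ)..2 * Real.pi, g u ≤ ∫ u in (0 : ℝ)..E S, g u := by
      rw [hg2pi, div_le_iff₀ (abs_pos.2 hJ0)]; linarith
    have hEle : 2 * Real.pi ≤ E S := hgmono.le_iff_le.1 hgle
    have := hτmono.monotone hEle
    simp only [hτE] at this
    exact this
  · have hL : ∀ t, HasDerivAt (fun t => ∫ u in (0 : ℝ)..E t, l u) (2 / r t - h) t := fun t => by
      refine ((hasDerivAt_integral hlc (E t)).comp t (hE' t)).congr_deriv ?_
      have h1 := (hApos (E t)).ne'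
      have h2 := (hr t).ne'
      simp only [hl, ← hrE t, hrA t]
      field_simp
    rw [intervalIntegral.integral_eq_sub_of_hasDerivAt (fun t _ => hL t)
      (Continuous.intervalIntegrable
        ((continuous_const.div hrc fun t => (hr t).ne').sub continuous_const) _ _), hET0, hE0, hl2pi]
    simp

/-! ### Radial metrics and their Euler-Lagrange equations -/

/-- The coefficient `α` for which `|dq|² + α(ρ) ⟨q, dq⟩²` has radial factor `1 + ρ f(ρ)`. -/
noncomputable def radialCoeff (f : ℝ → ℝ) (ρ : ℝ) : ℝ := 2 * f ρ / ρ + f ρ ^ 2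

/-- The Euclidean scalar product of the plane as a bilinear form. -/
noncomputable def euclideanForm : Plane →L[ℝ] Plane →L[ℝ] ℝ := innerSL ℝ

@[simp]
theorem euclideanForm_apply (v w : Plane) : euclideanForm v w = inner ℝ v w := rfl

/-- The bilinear form `(v, w) ↦ ⟨v, w⟩ + α ⟨q, v⟩ ⟨q, w⟩`. -/
noncomputable def radialForm (α : ℝ) (q : Plane) : Plane →L[ℝ] Plane →L[ℝ] ℝ :=
  euclideanForm + α • (euclideanForm q).smulRight (euclideanForm q)

theorem radialForm_apply (α : ℝ) (q v w : Plane) :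
    radialForm α q v w = inner ℝ v w + α * (inner ℝ q v * inner ℝ q w) := by
  simp [radialForm]

theorem inner_plane (v w : Plane) : inner ℝ v w = v 0 * w 0 + v 1 * w 1 := by
  simp [PiLp.inner_apply, Fin.sum_univ_two, mul_comm]

theorem norm_sq_plane (q : Plane) : ‖q‖ ^ 2 = q 0 ^ 2 + q 1 ^ 2 := by
  rw [EuclideanSpace.norm_sq_eq, Fin.sum_univ_two]; simp

/-- Conservation of the angular momentum and the radial equation, derived from the Euler-Lagrange
equations in Cartesian coordinates. -/
theorem angular_and_radial_equations {h : ℝ} {f : ℝ → ℝ} {x y vx vy r α' : ℝ → ℝ}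
    (hx : ∀ t, HasDerivAt x (vx t) t) (hy : ∀ t, HasDerivAt y (vy t) t)
    (hr : ∀ t, 0 < r t) (hr2 : ∀ t, r t ^ 2 = x t ^ 2 + y t ^ 2)
    (hr' : ∀ t, HasDerivAt r ((x t * vx t + y t * vy t) / r t) t)
    (hf : Differentiable ℝ f) (hpos : ∀ ρ, 0 < ρ → 0 < 1 + ρ * f ρ)
    (hα' : ∀ t, HasDerivAt (radialCoeff f) (α' t) (r t))
    (hP0 : ∀ t, HasDerivAt
      (fun s => vx s + radialCoeff f (r s) * ((x s * vx s + y s * vy s) * x s))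
      (1 / 2 * (α' t * (x t / r t)) * (x t * vx t + y t * vy t) ^ 2 +
        radialCoeff f (r t) * (x t * vx t + y t * vy t) * vx t - x t / r t ^ 3) t)
    (hP1 : ∀ t, HasDerivAt
      (fun s => vy s + radialCoeff f (r s) * ((x s * vx s + y s * vy s) * y s))
      (1 / 2 * (α' t * (y t / r t)) * (x t * vx t + y t * vy t) ^ 2 +
        radialCoeff f (r t) * (x t * vx t + y t * vy t) * vy t - y t / r t ^ 3) t)
    (he : ∀ t, vx t ^ 2 + vy t ^ 2 + radialCoeff f (r t) * (x t * vx t + y t * vy t) ^ 2 =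
      2 / r t - h) :
    ∃ J, (∀ t, x t * vy t - y t * vx t = J) ∧
      (∀ t, HasDerivAt (fun s => (1 + r s * f (r s)) * (x s * vx s + y s * vy s))
        ((1 / r t - h) / (1 + r t * f (r t))) t) ∧
      ∀ t, ((1 + r t * f (r t)) * (x t * vx t + y t * vy t)) ^ 2 + J ^ 2 =
        2 * r t - h * r t ^ 2 := by
  have hα : ∀ t, r t ^ 2 * radialCoeff f (r t) = (1 + r t * f (r t)) ^ 2 - 1 := fun t => by
    have := (hr t).ne'
    simp only [radialCoeff]
    field_simp
    ring
  -- The `α` part of the momentum is parallel to the position, so it drops out of the angular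
  -- momentum.
  have hJ : ∀ t, x t * vy t - y t * vx t = x 0 * vy 0 - y 0 * vx 0 := fun t => by
    refine eq_of_hasDerivAt_zero (f := fun t => x t * vy t - y t * vx t) (fun t => ?_) t 0
    have h1 := ((hx t).mul (hP1 t)).sub ((hy t).mul (hP0 t))
    refine (h1.congr_deriv (f' := _) (g' := 0) ?_).congr_of_eventuallyEq (.of_forall fun s => ?_)
    · ring
    · simp only [Pi.sub_apply, Pi.mul_apply]; ring
  refine ⟨_, hJ, fun t => ?_, fun t => ?_⟩
  · have ha := hpos _ (hr t)
    have hρ := (hr t).ne'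
    -- The pairing of position and momentum is `a² m` with `m = ⟨q, v⟩`; dividing by `a` gives `a
    -- m`, and in its derivative the terms with `f'` cancel.
    have h1 := ((hx t).mul (hP0 t)).add ((hy t).mul (hP1 t))
    have h2 := ((hr' t).mul ((hf (r t)).hasDerivAt.comp t (hr' t))).const_add 1
    have h3 := h1.div h2 (by simpa using ha.ne')
    have hαd : α' t = 2 * deriv f (r t) / r t - 2 * f (r t) / r t ^ 2
        + 2 * f (r t) * deriv f (r t) := by
      refine (hα' t).unique ?_
      have hfd := (hf (r t)).hasDerivAt
      refine (((hfd.const_mul 2).div (hasDerivAt_id _) hρ).add (hfd.pow 2)).congr_deriv ?_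
      simp only [id]
      field_simp
      ring
    have hαt : radialCoeff f (r t) = 2 * f (r t) / r t + f (r t) ^ 2 := rfl
    refine (h3.congr_deriv ?_).congr_of_eventuallyEq (.of_forall fun s => ?_)
    · have e := he t
      have e2 := hr2 t
      simp only [Pi.add_apply, Pi.mul_apply, Function.comp_apply]
      set m := x t * vx t + y t * vy t with hm
      have num1 : vx t * (vx t + radialCoeff f (r t) * (m * x t)) +
          x t * (1 / 2 * (α' t * (x t / r t)) * m ^ 2 + radialCoeff f (r t) * m * vx t
            - x t / r t ^ 3) +
          (vy t * (vy t + radialCoeff f (r t) * (m * y t)) +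
          y t * (1 / 2 * (α' t * (y t / r t)) * m ^ 2 + radialCoeff f (r t) * m * vy t
            - y t / r t ^ 3)) =
          (f (r t) / r t + deriv f (r t)) * (1 + r t * f (r t)) * m ^ 2 + 1 / r t - h := by
        have e3 : 1 / 2 * (α' t * r t) + radialCoeff f (r t) =
            (f (r t) / r t + deriv f (r t)) * (1 + r t * f (r t)) := by
          rw [hαd, hαt]; field_simp; ring
        rw [← e3]
        have e4 : (x t ^ 2 + y t ^ 2) / r t = r t := by rw [← e2]; field_simp
        have e5 : (x t ^ 2 + y t ^ 2) / r t ^ 3 = 1 / r t := by rw [← e2]; field_simp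
        linear_combination e + (1 / 2 * α' t * m ^ 2) * e4 - e5 - 2 * radialCoeff f (r t) * m * hm
      have num2 : x t * (vx t + radialCoeff f (r t) * (m * x t)) +
          y t * (vy t + radialCoeff f (r t) * (m * y t)) = (1 + r t * f (r t)) ^ 2 * m := by
        linear_combination m * hα t - m * radialCoeff f (r t) * e2 - hm
      rw [num1, num2]
      have ha' := ha.ne'
      field_simp
      ring
    · have has := (hpos _ (hr s)).ne'
      simp only [Pi.add_apply, Pi.mul_apply, Pi.div_apply, Function.comp_apply]
      rw [eq_div_iff has]
      linear_combination -(x s * vx s + y s * vy s) * hα s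
        + (x s * vx s + y s * vy s) * radialCoeff f (r s) * hr2 s
  · rw [← hJ t]
    have e := he t
    have e2 := hr2 t
    have e6 : r t ^ 2 * (2 / r t - h) = 2 * r t - h * r t ^ 2 := by
      have := (hr t).ne'
      field_simp
    rw [← e6, ← e]
    linear_combination -(x t * vx t + y t * vy t) ^ 2 * hα t - (vx t ^ 2 + vy t ^ 2) * e2

/-! ### From the Euler-Lagrange equation to the Zoll property -/

section Zoll

variable {f : ℝ → ℝ} {g : PlaneMetric}

theorem hasFDerivAt_norm_plane {q : Plane} (hq : q ≠ 0) :
    HasFDerivAt (fun q : Plane => ‖q‖) ((1 / ‖q‖) • innerSL ℝ q) q := by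
  have hn : ‖q‖ ≠ 0 := norm_ne_zero_iff.2 hq
  have h1 := (hasStrictFDerivAt_norm_sq q).hasFDerivAt.sqrt (by positivity)
  have : (fun q : Plane => Real.sqrt (‖q‖ ^ 2)) = fun q => ‖q‖ := by
    ext q; exact Real.sqrt_sq (norm_nonneg q)
  rw [this, Real.sqrt_sq (norm_nonneg q)] at h1
  refine h1.congr_fderiv ?_
  ext w
  simp
  field_simp

theorem fderiv_velocity_natLagrangian (V : Plane → ℝ) (q v w : Plane) :
    fderiv ℝ (fun v => natLagrangian g V q v) v w = g.form q v w := by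
  have h1 : HasFDerivAt (fun v => natLagrangian g V q v)
      ((1 / 2 : ℝ) • (g.form q v + (g.form q).flip v)) v := by
    have h2 := ((g.form q).hasFDerivAt (x := v)).clm_apply (hasFDerivAt_id v)
    refine ((h2.const_mul (1 / 2 : ℝ)).sub_const (V q)).congr_fderiv ?_
    ext w; simp
  rw [h1.fderiv]
  simp [g.symm q w v]
  ring

theorem fderiv_position_natLagrangian
    (hg : ∀ q, g.form q = radialForm (radialCoeff f ‖q‖) q) {q : Plane} (hq : q ≠ 0) {α' : ℝ}
    (hα' : HasDerivAt (radialCoeff f) α' ‖q‖) (v w : Plane) :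
    fderiv ℝ (fun q => natLagrangian g keplerPotential q v) q w =
      1 / 2 * (α' * (inner ℝ q w / ‖q‖)) * inner ℝ q v ^ 2 +
        radialCoeff f ‖q‖ * inner ℝ q v * inner ℝ w v - inner ℝ q w / ‖q‖ ^ 3 := by
  have hn : ‖q‖ ≠ 0 := norm_ne_zero_iff.2 hq
  have hnd := hasFDerivAt_norm_plane hq
  have hin : HasFDerivAt (fun q : Plane => (inner ℝ q v : ℝ)) (innerSL ℝ v) q := by
    have : (fun q : Plane => (inner ℝ q v : ℝ)) = fun q => innerSL ℝ v q := by
      ext q; simp [real_inner_comm]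
    rw [this]
    exact (innerSL ℝ v).hasFDerivAt
  have h1 := (hα'.comp_hasFDerivAt q hnd).mul (hin.pow 2)
  have h2 := ((hasDerivAt_inv hn).comp_hasFDerivAt q hnd)
  have h3 := ((h1.const_add (inner ℝ v v)).const_mul (1 / 2 : ℝ)).add h2
  have heq : (fun q => natLagrangian g keplerPotential q v) =
      (fun q => 1 / 2 * (inner ℝ v v + ((radialCoeff f ∘ fun q : Plane => ‖q‖) *
        (fun q : Plane => (inner ℝ q v : ℝ) ^ 2)) q)) + (Inv.inv ∘ fun q : Plane => ‖q‖) := by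
    ext q
    simp only [natLagrangian, hg, radialForm_apply, keplerPotential, Pi.add_apply, Pi.mul_apply,
      Function.comp_apply]
    ring
  rw [heq, h3.fderiv]
  simp [real_inner_comm v w]
  field_simp
  ring

/-- A rotationally invariant metric with radial factor `1 + ρ f(ρ)`, `f` odd about `1/h` on
`(0, 2/h)`, and angular factor `ρ` is Zoll on the level `-h/2` of the Kepler problem. -/
theorem isZollAt_of_radialForm {h : ℝ} (hh : 0 < h) (hf : Differentiable ℝ f)
    (hodd : ∀ ρ ∈ Set.Ioo 0 (2 / h), f (2 / h - ρ) = -f ρ)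
    (hpos : ∀ ρ, 0 < ρ → 0 < 1 + ρ * f ρ)
    (hg : ∀ q, g.form q = radialForm (radialCoeff f ‖q‖) q) :
    IsZollAt g keplerPotential (-h / 2) := by
  have hpi := Real.pi_pos
  have hs := Real.sqrt_pos.2 hh
  refine ⟨2 * Real.pi / Real.sqrt h, by positivity, fun X hX hen => ?_⟩
  set r : ℝ → ℝ := fun t => ‖X t‖ with hrdef
  have hr : ∀ t, 0 < r t := fun t => norm_pos_iff.2 (hX.ne_zero t)
  have hXd : ∀ t, HasDerivAt X (deriv X t) t := fun t =>
    ((hX.contDiff.differentiable (by norm_num)) t).hasDerivAt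
  have hcoord : ∀ i t, HasDerivAt (fun s => X s i) (deriv X t i) t := fun i t =>
    ((EuclideanSpace.proj i : Plane →L[ℝ] ℝ).hasFDerivAt.comp_hasDerivAt t (hXd t))
  have hr2 : ∀ t, r t ^ 2 = X t 0 ^ 2 + X t 1 ^ 2 := fun t => norm_sq_plane _
  have hr' : ∀ t, HasDerivAt r ((X t 0 * deriv X t 0 + X t 1 * deriv X t 1) / r t) t := fun t => by
    refine ((hasFDerivAt_norm_plane (hX.ne_zero t)).comp_hasDerivAt t (hXd t)).congr_deriv ?_
    simp [inner_plane, hrdef]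
    ring
  have hα' : ∀ t, HasDerivAt (radialCoeff f) (deriv (radialCoeff f) (r t)) (r t) := fun t => by
    refine DifferentiableAt.hasDerivAt ?_
    unfold radialCoeff
    have := (hr t).ne'
    exact ((hf.const_mul 2 _).div differentiableAt_id this).add ((hf _).pow 2)
  have hP : ∀ i t, HasDerivAt (fun s => deriv X s i + radialCoeff f (r s) *
      ((X s 0 * deriv X s 0 + X s 1 * deriv X s 1) * X s i))
      (1 / 2 * (deriv (radialCoeff f) (r t) * (X t i / r t)) *
        (X t 0 * deriv X t 0 + X t 1 * deriv X t 1) ^ 2 +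
        radialCoeff f (r t) * (X t 0 * deriv X t 0 + X t 1 * deriv X t 1) * deriv X t i
        - X t i / r t ^ 3) t := fun i t => by
    have h1 := (hX.euler_lagrange t).clm_apply
      (hasDerivAt_const t (EuclideanSpace.single i (1 : ℝ) : Plane))
    simp only [fderiv_velocity_natLagrangian, map_zero, add_zero,
      fderiv_position_natLagrangian hg (hX.ne_zero t) (hα' t)] at h1
    simpa [hg, radialForm_apply, inner_plane, ← hrdef, EuclideanSpace.inner_single_right,
      EuclideanSpace.inner_single_left] using h1
  have hen' : ∀ t, deriv X t 0 ^ 2 + deriv X t 1 ^ 2 + radialCoeff f (r t) *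
      (X t 0 * deriv X t 0 + X t 1 * deriv X t 1) ^ 2 = 2 / r t - h := fun t => by
    have h1 := hen t
    simp only [natEnergy, hg, radialForm_apply, keplerPotential, inner_plane] at h1
    simp only [hrdef]
    linear_combination 2 * h1
  obtain ⟨J, hJ, hm, he⟩ := angular_and_radial_equations (hcoord 0) (hcoord 1) hr hr2 hr' hf hpos
    hα' (hP 0) (hP 1) hen'
  obtain ⟨T, hT, hlen⟩ := exists_isLeast_period hh hf.continuous hodd hpos (hcoord 0) (hcoord 1)
    hr hr2 hr' hJ hm he
  refine ⟨T, ?_, ?_⟩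
  · convert hT using 4 with S
    constructor
    · exact fun hp => ⟨fun t => by simp only [hp t], fun t => by simp only [hp t]⟩
    · rintro ⟨h0, h1⟩ t
      ext i
      fin_cases i
      · exact h0 t
      · exact h1 t
  · rw [← hlen, jacobiLength]
    refine intervalIntegral.integral_congr fun t _ => ?_
    have h1 : g.form (X t) (deriv X t) (deriv X t) = 2 / r t - h := by
      rw [← hen' t, hg, radialForm_apply, inner_plane, inner_plane]; ring
    have h2 : 0 ≤ 2 / r t - h := by
      have h3 : r t ^ 2 * (2 / r t - h) = 2 * r t - h * r t ^ 2 := by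
        have := (hr t).ne'
        field_simp
      have h4 : 0 ≤ r t ^ 2 * (2 / r t - h) := by rw [h3, ← he t]; positivity
      exact nonneg_of_mul_nonneg_right h4 (pow_pos (hr t) 2)
    -- On the level, both `2(e - V)` and the squared speed equal `2/r - h ≥ 0`, so the Jacobi length
    -- element has no square root left.
    have h3 : jacobiMetric g keplerPotential (-h / 2) (X t) (deriv X t) (deriv X t) =
        (2 / r t - h) ^ 2 := by
      simp only [jacobiMetric, smul_apply, h1, keplerPotential, hrdef,
        smul_eq_mul]
      ring
    simp only [h3, Real.sqrt_sq h2]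

end Zoll

/-! ### Positivity, smoothness and invariance of radial metrics -/

section Metric

/-- Since `⟨q, dq⟩ = ρ dρ`, the left side is the coefficient of `dρ²` in the metric. -/
theorem sq_radialFactor (f : ℝ → ℝ) {ρ : ℝ} (hρ : ρ ≠ 0) :
    1 + ρ ^ 2 * radialCoeff f ρ = (1 + ρ * f ρ) ^ 2 := by
  simp only [radialCoeff]
  field_simp
  ring

theorem radialForm_symm (α : ℝ) (q v w : Plane) : radialForm α q v w = radialForm α q w v := by
  simp only [radialForm_apply, real_inner_comm v w]
  ring

/-- A nonnegative coefficient only adds to the Euclidean form. For a negative one, Cauchy-Schwarz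
bounds the form below by `‖v‖² (1 + ρ f(ρ))²`. -/
theorem radialForm_pos {f : ℝ → ℝ} (hpos : ∀ ρ, 0 < ρ → 0 < 1 + ρ * f ρ) (q v : Plane)
    (hv : v ≠ 0) : 0 < radialForm (radialCoeff f ‖q‖) q v v := by
  rw [radialForm_apply, real_inner_self_eq_norm_sq]
  have hv' : 0 < ‖v‖ := norm_pos_iff.2 hv
  rcases eq_or_ne q 0 with rfl | hq
  · simpa using pow_pos hv' 2
  have hq' : 0 < ‖q‖ := norm_pos_iff.2 hq
  have h1 := sq_radialFactor f hq'.ne'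
  have h2 := pow_pos (hpos _ hq') 2
  have h3 : (inner ℝ q v : ℝ) * inner ℝ q v ≤ ‖q‖ ^ 2 * ‖v‖ ^ 2 := by
    have := real_inner_mul_inner_self_le q v
    rwa [real_inner_self_eq_norm_sq, real_inner_self_eq_norm_sq] at this
  rcases le_or_gt 0 (radialCoeff f ‖q‖) with h0 | h0
  · nlinarith [mul_nonneg h0 (mul_self_nonneg (inner ℝ q v : ℝ)), pow_pos hv' 2]
  · have h4 := mul_le_mul_of_nonpos_left h3 h0.le
    have h5 := mul_pos (pow_pos hv' 2) (h1 ▸ h2)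
    linarith

theorem radialForm_isometry (α : ℝ) (U : Plane ≃ₗᵢ[ℝ] Plane) (q v w : Plane) :
    radialForm α (U q) (U v) (U w) = radialForm α q v w := by
  simp only [radialForm_apply, LinearIsometryEquiv.inner_map_map]

/-- Smooth families of profiles vanishing near the origin give smooth families of metrics. -/
theorem contDiff_radialForm {E : Type*} [NormedAddCommGroup E] [NormedSpace ℝ E]
    {F : E → ℝ → ℝ} (hF : ContDiff ℝ ∞ fun p : E × ℝ => F p.1 p.2) {δ : ℝ} (hδ : 0 < δ)
    (hzero : ∀ t ρ, 0 ≤ ρ → ρ < δ → F t ρ = 0) :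
    ContDiff ℝ ∞ fun p : E × Plane => radialForm (radialCoeff (F p.1) ‖p.2‖) p.2 := by
  have hcoeff : ContDiff ℝ ∞ fun p : E × Plane => radialCoeff (F p.1) ‖p.2‖ := by
    rw [contDiff_iff_contDiffAt]
    rintro ⟨t, q⟩
    -- The norm is not smooth at the origin, but there the coefficient vanishes on a whole
    -- neighbourhood, uniformly in the parameter.
    rcases eq_or_ne q 0 with rfl | hq
    · have hev : (fun p : E × Plane => radialCoeff (F p.1) ‖p.2‖) =ᶠ[nhds (t, 0)]
          fun _ => 0 := by
        have hopen : IsOpen {p : E × Plane | ‖p.2‖ < δ} :=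
          isOpen_lt (by fun_prop) continuous_const
        filter_upwards [hopen.mem_nhds (by simpa using hδ)] with p hp
        simp [radialCoeff, hzero p.1 _ (norm_nonneg _) hp]
      exact contDiffAt_const.congr_of_eventuallyEq hev
    · have hnorm : ContDiffAt ℝ ∞ (fun p : E × Plane => ‖p.2‖) (t, q) :=
        contDiffAt_snd.norm ℝ hq
      have hFn : ContDiffAt ℝ ∞ (fun p : E × Plane => F p.1 ‖p.2‖) (t, q) :=
        hF.contDiffAt.comp (t, q) (contDiffAt_fst.prodMk hnorm)
      exact ((contDiffAt_const.mul hFn).div hnorm (norm_ne_zero_iff.2 hq)).add (hFn.pow 2)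
  have h1 : ContDiff ℝ ∞ fun p : E × Plane => euclideanForm p.2 :=
    euclideanForm.contDiff.comp contDiff_snd
  have h2 : ContDiff ℝ ∞ fun p : E × Plane =>
      (euclideanForm p.2).smulRight (radialCoeff (F p.1) ‖p.2‖ • euclideanForm p.2) :=
    h1.smulRight (hcoeff.smul h1)
  have h3 : (fun p : E × Plane => radialForm (radialCoeff (F p.1) ‖p.2‖) p.2) = fun p =>
      euclideanForm + (euclideanForm p.2).smulRight (radialCoeff (F p.1) ‖p.2‖ • euclideanForm p.2) := by
    ext p v w
    simp only [radialForm_apply, add_apply, ContinuousLinearMap.smulRight_apply, smul_apply,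
      euclideanForm_apply, smul_eq_mul]
    ring
  rw [h3]
  exact contDiff_const.add h2

theorem contDiff_radialForm_const {f : ℝ → ℝ} (hf : ContDiff ℝ ∞ f)
    (hzero : ∃ δ > 0, ∀ ρ, 0 ≤ ρ → ρ < δ → f ρ = 0) :
    ContDiff ℝ ∞ fun q : Plane => radialForm (radialCoeff f ‖q‖) q := by
  obtain ⟨δ, hδ, hz⟩ := hzero
  have h0 : ContDiff ℝ ∞ fun p : ℝ × ℝ => f p.2 := hf.comp contDiff_snd
  have h1 := contDiff_radialForm (F := fun _ : ℝ => f) h0 hδ fun _ => hz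
  have h2 (c : ℝ) : ContDiff ℝ ∞ fun q : Plane => radialForm (radialCoeff f ‖q‖) q :=
    ContDiff.comp (f := fun q : Plane => (c, q)) h1 (by fun_prop)
  exact h2 0

/-- The rotationally invariant metric with radial factor `1 + ρ f(ρ)` and angular factor `ρ`. -/
noncomputable def radialMetric (f : ℝ → ℝ) (hf : ContDiff ℝ ∞ f)
    (hzero : ∃ δ > 0, ∀ ρ, 0 ≤ ρ → ρ < δ → f ρ = 0)
    (hpos : ∀ ρ, 0 < ρ → 0 < 1 + ρ * f ρ) : PlaneMetric where
  form q := radialForm (radialCoeff f ‖q‖) q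
  smooth := contDiff_radialForm_const hf hzero
  symm q v w := radialForm_symm _ q v w
  pos q v hv := radialForm_pos hpos q v hv

theorem radialMetric_rotInvariant {f : ℝ → ℝ} {hf : ContDiff ℝ ∞ f}
    {hzero : ∃ δ > 0, ∀ ρ, 0 ≤ ρ → ρ < δ → f ρ = 0}
    {hpos : ∀ ρ, 0 < ρ → 0 < 1 + ρ * f ρ} : (radialMetric f hf hzero hpos).RotInvariant := by
  intro U q v w
  simp only [radialMetric, LinearIsometryEquiv.norm_map, radialForm_isometry]

end Metric

/-! ### Integer combinations of the `ξᵢ` -/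

section Combinations

variable {n : ℕ} {h : Fin (n + 1) → ℝ}

/-- Pairwise rational dependence makes the numbers `ξᵢ` integer multiples of a common number. -/
theorem exists_common_divisor (hdep : ∀ i j, RatDependent (xi h i) (xi h j)) {j : Fin (n + 1)}
    (hj : 0 < xi h j) : ∃ η > 0, ∀ i, ∃ k : ℤ, xi h i = k * η := by
  choose p q hpq heq using fun i => hdep i j
  have hp : ∀ i, p i ≠ 0 := fun i hpi => by
    have hq : q i ≠ 0 := (hpq i).resolve_left (not_not.2 hpi)
    have := heq i
    rw [hpi, Int.cast_zero, zero_mul, zero_add, mul_eq_zero] at this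
    rcases this with h1 | h1
    · exact hq (by exact_mod_cast h1)
    · exact hj.ne' h1
  have hD : ((∏ i, |p i| : ℤ) : ℝ) ≠ 0 := by
    rw [Int.cast_ne_zero, Finset.prod_ne_zero_iff]
    exact fun i _ => abs_ne_zero.2 (hp i)
  -- Each relation reads `ξᵢ = -(qᵢ/pᵢ) ξⱼ`; the product of the `|pᵢ|` serves as a common
  -- denominator.
  refine ⟨xi h j / (∏ i, |p i| : ℤ), div_pos hj (lt_of_le_of_ne ?_ hD.symm), fun i => ?_⟩
  · exact_mod_cast Finset.prod_nonneg fun i _ => abs_nonneg (p i)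
  · obtain ⟨d, hd⟩ : p i ∣ ∏ i, |p i| :=
      ((dvd_abs (p i) (p i)).2 dvd_rfl).trans (Finset.dvd_prod_of_mem _ (Finset.mem_univ i))
    refine ⟨-q i * d, ?_⟩
    have hpi : (p i : ℝ) ≠ 0 := by exact_mod_cast hp i
    have hd' : ((∏ i, |p i| : ℤ) : ℝ) = p i * d := by rw [hd]; push_cast; rfl
    rw [hd'] at hD ⊢
    have hd0 : (d : ℝ) ≠ 0 := right_ne_zero_of_mul hD
    push_cast
    field_simp
    linear_combination heq i

/-- All positive combinations are natural multiples of one `η > 0`, so the well-ordering of `ℕ`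
gives a minimum; `ξⱼ` itself shows that the set is nonempty. -/
theorem isLeast_gammaInf (hdep : ∀ i j, RatDependent (xi h i) (xi h j)) {j : Fin (n + 1)}
    (hj : 0 < xi h j) : IsLeast (posCombinations h) (gammaInf h) := by
  obtain ⟨η, hη, hk⟩ := exists_common_divisor hdep hj
  choose k hk using hk
  have hmul : ∀ s ∈ posCombinations h, ∃ m : ℕ, s = m * η := by
    rintro s ⟨hs, a, rfl⟩
    have e : ∑ i, (a i : ℝ) * xi h i = (∑ i, a i * k i : ℤ) * η := by
      push_cast
      rw [Finset.sum_mul]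
      exact Finset.sum_congr rfl fun i _ => by rw [hk i]; ring
    rw [e] at hs ⊢
    have hpos : 0 < ∑ i, a i * k i := by
      have := (mul_pos_iff_of_pos_right hη).1 hs
      exact_mod_cast this
    refine ⟨(∑ i, a i * k i).toNat, ?_⟩
    congr 1
    exact_mod_cast (Int.toNat_of_nonneg hpos.le).symm
  have hjmem : xi h j ∈ posCombinations h := by
    refine ⟨hj, Pi.single j 1, ?_⟩
    rw [Finset.sum_eq_single j]
    · simp
    · intro i _ hij; simp [Pi.single_eq_of_ne hij]
    · simp
  set K : Set ℕ := {m | (m : ℝ) * η ∈ posCombinations h} with hK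
  have hne : K.Nonempty := by
    obtain ⟨m, hm⟩ := hmul _ hjmem
    exact ⟨m, by rw [hK, Set.mem_ofPred_eq, ← hm]; exact hjmem⟩
  have hleast : IsLeast (posCombinations h) ((sInf K : ℕ) * η) := by
    refine ⟨Nat.sInf_mem hne, fun s hs => ?_⟩
    obtain ⟨m, rfl⟩ := hmul s hs
    gcongr
    exact Nat.sInf_le hs
  rw [gammaInf, hleast.csInf_eq]
  exact hleast

/-- Division with remainder: the remainder of `ξᵢ` modulo `γ` is again an integer combination, lies
in `[0, γ)`, and must vanish by minimality. -/
theorem xi_eq_mul_of_isLeast {γ : ℝ} (hγ : IsLeast (posCombinations h) γ) (i : Fin (n + 1)) :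
    ∃ k : ℤ, xi h i = k * γ := by
  obtain ⟨⟨hγ0, a, ha⟩, hmin⟩ := hγ
  refine ⟨⌊xi h i / γ⌋, ?_⟩
  by_contra hne
  have h1 : (⌊xi h i / γ⌋ : ℝ) * γ ≤ xi h i := (le_div_iff₀ hγ0).1 (Int.floor_le _)
  have h2 : xi h i < (⌊xi h i / γ⌋ + 1) * γ := (div_lt_iff₀ hγ0).1 (Int.lt_floor_add_one _)
  have hmem : xi h i - ⌊xi h i / γ⌋ * γ ∈ posCombinations h := by
    refine ⟨sub_pos.2 (lt_of_le_of_ne h1 (Ne.symm hne)),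
      fun j => (if j = i then 1 else 0) - ⌊xi h i / γ⌋ * a j, ?_⟩
    push_cast
    simp only [sub_mul, Finset.sum_sub_distrib, mul_assoc, ← Finset.mul_sum, ← ha, ite_mul, one_mul,
      zero_mul, Finset.sum_ite_eq', Finset.mem_univ, if_true]
  have := hmin hmem
  linarith

end Combinations

/-! ### Profiles odd about all the centres `1/hᵢ` -/

section Profile

/-- The profile of the metric attached to `u`: up to a cutoff and a normalization it is
`sin φ · arctan (u (2γ (cos φ - c)))` with the phase `φ = κ (ρ - ρ₀)`, hence periodic in `φ` and odd
about `ρ₀`. -/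
noncomputable def zollProfile (γ κ ρ₀ R c : ℝ) (u : ℝ → ℝ) (ρ : ℝ) : ℝ :=
  Real.smoothTransition (R + 1 - ρ) * (1 / (2 * (R + 1)) * Real.sin (κ * (ρ - ρ₀))) *
    Real.arctan (u (2 * γ * (Real.cos (κ * (ρ - ρ₀)) - c)))

variable {γ κ ρ₀ R c : ℝ} {u : ℝ → ℝ}

theorem contDiff_zollProfile {E : Type*} [NormedAddCommGroup E] [NormedSpace ℝ E]
    {u : E → ℝ → ℝ} (hu : ContDiff ℝ ∞ fun p : E × ℝ => u p.1 p.2) :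
    ContDiff ℝ ∞ fun p : E × ℝ => zollProfile γ κ ρ₀ R c (u p.1) p.2 := by
  have h1 : ContDiff ℝ ∞ fun p : E × ℝ => u p.1 (2 * γ * (Real.cos (κ * (p.2 - ρ₀)) - c)) :=
    hu.comp (contDiff_fst.prodMk
      (g := fun p : E × ℝ => 2 * γ * (Real.cos (κ * (p.2 - ρ₀)) - c)) (by fun_prop))
  have h2 : ContDiff ℝ ∞ fun p : E × ℝ => Real.smoothTransition (R + 1 - p.2) :=
    Real.smoothTransition.contDiff.comp (by fun_prop)
  exact (h2.mul (by fun_prop)).mul (Real.contDiff_arctan.comp h1)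

/-- Beyond `R + 1` the cutoff kills the profile. Below, `|arctan| < π/2 < 2` and the normalization
bound it by `1/(R + 1)`, so `|ρ f(ρ)| < 1`. -/
theorem zollProfile_pos (hR : 0 ≤ R) {ρ : ℝ} (hρ : 0 < ρ) :
    0 < 1 + ρ * zollProfile γ κ ρ₀ R c u ρ := by
  rcases le_or_gt (R + 1) ρ with h | h
  · simp [zollProfile, Real.smoothTransition.zero_of_nonpos (sub_nonpos.2 h)]
  · have h1 : |zollProfile γ κ ρ₀ R c u ρ| ≤ 1 * (1 / (2 * (R + 1)) * 1) * 2 := by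
      rw [zollProfile, abs_mul, abs_mul, abs_mul,
        abs_of_nonneg (Real.smoothTransition.nonneg _),
        abs_of_nonneg (by positivity : 0 ≤ 1 / (2 * (R + 1)))]
      gcongr
      · exact Real.smoothTransition.le_one _
      · exact Real.abs_sin_le_one _
      · have := Real.arctan_lt_pi_div_two (u (2 * γ * (Real.cos (κ * (ρ - ρ₀)) - c)))
        have := Real.neg_pi_div_two_lt_arctan (u (2 * γ * (Real.cos (κ * (ρ - ρ₀)) - c)))
        have := Real.pi_lt_four
        rw [abs_le]; constructor <;> linarith
    have h2 : |ρ * zollProfile γ κ ρ₀ R c u ρ| < 1 := by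
      rw [abs_mul, abs_of_pos hρ]
      calc ρ * |zollProfile γ κ ρ₀ R c u ρ| ≤ ρ * (1 * (1 / (2 * (R + 1)) * 1) * 2) := by gcongr
        _ = ρ / (R + 1) := by field_simp
        _ < 1 := (div_lt_one (by positivity)).2 h
    linarith [(abs_lt.1 h2).1]

/-- The profile on the range where the cutoff is inactive. -/
theorem zollProfile_of_le {ρ : ℝ} (hρ : ρ ≤ R) : zollProfile γ κ ρ₀ R c u ρ =
    1 / (2 * (R + 1)) * Real.sin (κ * (ρ - ρ₀)) *
      Real.arctan (u (2 * γ * (Real.cos (κ * (ρ - ρ₀)) - c))) := by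
  rw [zollProfile, Real.smoothTransition.one_of_one_le (by linarith), one_mul]

/-- The reflection `ρ ↦ b - ρ` sends the phase `φ` to `2πk - φ`, which preserves the cosine and
negates the sine. It is applied with `b = 2/hᵢ`. -/
theorem zollProfile_reflect {ρ b : ℝ} (hρ : ρ ≤ R) (hbρ : b - ρ ≤ R)
    (hb : ∃ k : ℤ, κ * (b - 2 * ρ₀) = k * (2 * Real.pi)) :
    zollProfile γ κ ρ₀ R c u (b - ρ) = -zollProfile γ κ ρ₀ R c u ρ := by
  obtain ⟨k, hk⟩ := hb
  have e : κ * (b - ρ - ρ₀) = k * (2 * Real.pi) - κ * (ρ - ρ₀) := by rw [← hk]; ring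
  rw [zollProfile_of_le hρ, zollProfile_of_le hbρ, e, Real.cos_int_mul_two_pi_sub,
    Real.sin_int_mul_two_pi_sub]
  ring

/-- There is a window of values of the cosine which is avoided near the origin. -/
theorem exists_window (hκ : 0 < κ) (ρ₀ : ℝ) : ∃ c δ : ℝ, -1 < c ∧ c < 1 / 2 ∧ 0 < δ ∧
    ∀ ρ, 0 ≤ ρ → ρ < δ → Real.cos (κ * (ρ - ρ₀)) ∉ Set.Ioo c (c + 1 / 2) := by
  have hclose : ∀ ρ, 0 ≤ ρ → ρ < 1 / (4 * κ) →
      |Real.cos (κ * (ρ - ρ₀)) - Real.cos (κ * (0 - ρ₀))| < 1 / 4 := fun ρ h0 h1 => by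
    have h2 : |Real.cos (κ * (ρ - ρ₀)) - Real.cos (κ * (0 - ρ₀))| ≤
        |κ * (ρ - ρ₀) - κ * (0 - ρ₀)| := by
      simpa [Real.dist_eq] using
        Real.lipschitzWith_cos.dist_le_mul (κ * (ρ - ρ₀)) (κ * (0 - ρ₀))
    refine h2.trans_lt ?_
    rw [show κ * (ρ - ρ₀) - κ * (0 - ρ₀) = κ * ρ by ring, abs_of_nonneg (by positivity)]
    rw [lt_div_iff₀ (by positivity)] at h1
    linarith
  -- The cosine moves by less than `1/4` from its value at `ρ = 0`. According to the sign of that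
  -- value, the window is `(-3/4, -1/4)` or `(1/4, 3/4)`.
  rcases le_or_gt 0 (Real.cos (κ * (0 - ρ₀))) with h | h
  · refine ⟨-3 / 4, 1 / (4 * κ), by norm_num, by norm_num, by positivity, fun ρ h0 h1 hm => ?_⟩
    have := abs_lt.1 (hclose ρ h0 h1)
    linarith [hm.2]
  · refine ⟨1 / 4, 1 / (4 * κ), by norm_num, by norm_num, by positivity, fun ρ h0 h1 hm => ?_⟩
    have := abs_lt.1 (hclose ρ h0 h1)
    linarith [hm.1]

theorem zollProfile_eq_zero (hγ : 0 < γ) (hu : ∀ y, y ∉ Set.Ioo 0 γ → u y = 0) {ρ : ℝ}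
    (hρ : Real.cos (κ * (ρ - ρ₀)) ∉ Set.Ioo c (c + 1 / 2)) :
    zollProfile γ κ ρ₀ R c u ρ = 0 := by
  have : u (2 * γ * (Real.cos (κ * (ρ - ρ₀)) - c)) = 0 := by
    refine hu _ fun hm => hρ ⟨?_, ?_⟩
    · have := pos_of_mul_pos_right hm.1 (by positivity)
      linarith
    · have := hm.2
      by_contra hcon
      nlinarith
  simp [zollProfile, this]

/-- Every value of `u` on `(0, γ)` is visible in the profile on `(0, ρ₀ + π / κ)`. -/
theorem exists_radius (hγ : 0 < γ) (hκ : 0 < κ) (hρ₀ : 0 < ρ₀) (hR : ρ₀ + Real.pi / κ ≤ R)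
    (hc : -1 < c) (hc' : c < 1 / 2) {y : ℝ} (hy : y ∈ Set.Ioo 0 γ) :
    ∃ ρ K : ℝ, 0 < ρ ∧ ρ ≤ R ∧ K ≠ 0 ∧
      ∀ u : ℝ → ℝ, zollProfile γ κ ρ₀ R c u ρ = K * Real.arctan (u y) := by
  -- The cosine value at which `u` is evaluated at `y`. It lies strictly between `-1` and `1`, so
  -- the sine factor at the phase `arccos s` is nonzero.
  set s : ℝ := c + y / (2 * γ) with hs
  have h1 : 0 < y / (2 * γ) := div_pos hy.1 (by positivity)
  have h2 : y / (2 * γ) < 1 / 2 := by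
    rw [div_lt_iff₀ (by positivity)]; linarith [hy.2]
  have hR0 : 0 < R := by have := Real.pi_pos; exact lt_of_lt_of_le (by positivity) hR
  have hle : ρ₀ + Real.arccos s / κ ≤ R := by
    refine le_trans ?_ hR
    gcongr
    exact Real.arccos_le_pi s
  have hphase : κ * (ρ₀ + Real.arccos s / κ - ρ₀) = Real.arccos s := by field_simp; ring
  refine ⟨ρ₀ + Real.arccos s / κ, 1 / (2 * (R + 1)) * Real.sin (Real.arccos s), ?_, hle, ?_,
    fun u => ?_⟩
  · have := Real.arccos_nonneg s
    positivity
  · refine mul_ne_zero (by positivity) ?_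
    rw [Real.sin_arccos]
    exact (Real.sqrt_pos.2 (by nlinarith)).ne'
  · rw [zollProfile_of_le hle, hphase, Real.cos_arccos (by linarith) (by linarith)]
    congr 3
    rw [hs]; field_simp; ring

end Profile

/-! ### Families of Zoll metrics parametrized by test functions -/

section Family

/-- Every finite number of parameters can be accommodated linearly and injectively in the space of
test functions on a nonempty interval. -/
theorem exists_injective_linearMap {γ : ℝ} (hγ : 0 < γ) (N : ℕ) :
    ∃ A : EuclideanSpace ℝ (Fin N) →ₗ[ℝ] 𝓓(openInterval γ, ℝ), Function.Injective A := by
  -- Bumps of radius `ε/2` centred at `ε, 2ε, …, Nε` stay inside `(0, γ)`; evaluation at the centres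
  -- recovers the coefficients.
  set ε : ℝ := γ / (N + 1) with hε
  have hε0 : 0 < ε := by positivity
  have hγε : γ = (N + 1) * ε := by rw [hε]; field_simp
  set b : ∀ j : Fin N, ContDiffBump (((j : ℕ) + 1 : ℝ) * ε) := fun j =>
    { rIn := ε / 4, rOut := ε / 2, rIn_pos := by positivity, rIn_lt_rOut := by linarith } with hb
  have hsub : ∀ j, tsupport (b j) ⊆ (openInterval γ : Set ℝ) := fun j y hy => by
    rw [(b j).tsupport_eq, Metric.mem_closedBall, Real.dist_eq, abs_le] at hy
    have hj : ((j : ℕ) + 1 : ℝ) ≤ N := by exact_mod_cast j.2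
    have hj0 : (0 : ℝ) ≤ (j : ℕ) := Nat.cast_nonneg _
    have h1 : (b j).rOut = ε / 2 := rfl
    rw [h1] at hy
    change 0 < y ∧ y < γ
    rw [hγε]
    constructor <;> nlinarith
  set B : Fin N → 𝓓(openInterval γ, ℝ) := fun j =>
    ⟨b j, (b j).contDiff, (b j).hasCompactSupport, hsub j⟩ with hB
  have hBk : ∀ j k : Fin N, B j (((k : ℕ) + 1 : ℝ) * ε) = if j = k then 1 else 0 := fun j k => by
    change b j _ = _
    split_ifs with hjk
    · subst hjk
      exact (b j).one_of_mem_closedBall (by simp [(b j).rIn_pos.le])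
    · refine (b j).zero_of_le_dist ?_
      have h1 : (b j).rOut = ε / 2 := rfl
      have h2 : (1 : ℝ) ≤ |((k : ℕ) : ℝ) - (j : ℕ)| := by
        have h3 : ((k : ℕ) : ℤ) - (j : ℕ) ≠ 0 := by
          intro h0
          exact hjk (Fin.ext (by omega))
        have := Int.one_le_abs h3
        exact_mod_cast this
      rw [h1, Real.dist_eq, show ((k : ℕ) + 1 : ℝ) * ε - ((j : ℕ) + 1 : ℝ) * ε =
        (((k : ℕ) : ℝ) - (j : ℕ)) * ε by ring, abs_mul, abs_of_pos hε0]
      nlinarith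
  let ev (y : ℝ) : 𝓓(openInterval γ, ℝ) →ₗ[ℝ] ℝ :=
    { toFun := fun u => u y, map_add' := fun _ _ => rfl, map_smul' := fun _ _ => rfl }
  refine ⟨(Fintype.linearCombination ℝ B).comp
    (EuclideanSpace.equiv (Fin N) ℝ).toLinearEquiv.toLinearMap, ?_⟩
  have hval : ∀ (t : EuclideanSpace ℝ (Fin N)) (k : Fin N),
      ((Fintype.linearCombination ℝ B).comp
        (EuclideanSpace.equiv (Fin N) ℝ).toLinearEquiv.toLinearMap) t
          (((k : ℕ) + 1 : ℝ) * ε) = t k := fun t k => by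
    change ev _ (Fintype.linearCombination ℝ B _) = _
    rw [Fintype.linearCombination_apply, map_sum]
    have : ∀ j, ev (((k : ℕ) + 1 : ℝ) * ε) (t j • B j) = if j = k then t j else 0 := fun j => by
      rw [map_smul]
      change t j • B j _ = _
      rw [hBk]
      simp
    exact (Finset.sum_congr rfl fun j _ => this j).trans (by simp)
  intro s t hst
  ext k
  rw [← hval s k, ← hval t k, hst]

/-- Linear maps from a Euclidean space to test functions are jointly smooth. -/
theorem contDiff_linearMap_apply {γ : ℝ} {N : ℕ}
    (A : EuclideanSpace ℝ (Fin N) →ₗ[ℝ] 𝓓(openInterval γ, ℝ)) :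
    ContDiff ℝ ∞ fun p : EuclideanSpace ℝ (Fin N) × ℝ => A p.1 p.2 := by
  have h1 : (fun p : EuclideanSpace ℝ (Fin N) × ℝ => A p.1 p.2) = fun p =>
      ∑ i, p.1 i * A (EuclideanSpace.single i 1) p.2 := by
    ext ⟨t, y⟩
    let ev : 𝓓(openInterval γ, ℝ) →ₗ[ℝ] ℝ :=
      { toFun := fun u => u y, map_add' := fun _ _ => rfl, map_smul' := fun _ _ => rfl }
    have h2 : t = ∑ i, t i • (EuclideanSpace.single i (1 : ℝ) : EuclideanSpace ℝ (Fin N)) := by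
      have := (EuclideanSpace.basisFun (Fin N) ℝ).sum_repr t
      simpa using this.symm
    change (ev ∘ₗ A) t = ∑ i, t i * (ev ∘ₗ A) (EuclideanSpace.single i 1)
    conv_lhs => rw [h2]
    simp only [map_sum, map_smul, smul_eq_mul]
  rw [h1]
  refine ContDiff.sum fun i _ => ContDiff.mul ?_ ?_
  · exact (EuclideanSpace.proj i : EuclideanSpace ℝ (Fin N) →L[ℝ] ℝ).contDiff.comp contDiff_fst
  · exact (A (EuclideanSpace.single i 1)).contDiff.comp contDiff_snd

variable {n : ℕ} {h : Fin (n + 1) → ℝ}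

theorem mem_totalHillRegion (hpos : ∀ i, 0 < h i) {q : Plane} (hq : q ≠ 0) {i : Fin (n + 1)}
    (hi : ‖q‖ ≤ 2 / h i) : q ∈ totalHillRegion h := by
  refine Set.mem_iUnion.2 ⟨i, hq, ?_⟩
  have hn := norm_pos_iff.2 hq
  have := hpos i
  rw [le_div_iff₀ this] at hi
  rw [keplerPotential, neg_div, neg_le_neg_iff, div_le_div_iff₀ two_pos hn]
  linarith

/-- Test functions on `(0, γ)` parametrize Zoll metrics: the metric `Φ u` depends smoothly on `u`,
and detects every value of `u` on `(0, γ)`. -/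
theorem exists_zollMetric_parametrization (hpos : ∀ i, 0 < h i) (hanti : StrictAnti h)
    {γ : ℝ} (hγ : 0 < γ) (hmul : ∀ i, ∃ k : ℤ, xi h i = k * γ) (hle : γ ≤ xi h (Fin.last n)) :
    ∃ Φ : 𝓓(openInterval γ, ℝ) → ZollMetric h,
      (∀ y ∈ Set.Ioo 0 γ, ∃ (q : Plane) (K : ℝ), q ∈ totalHillRegion h ∧ K ≠ 0 ∧
        ∀ u : 𝓓(openInterval γ, ℝ), (Φ u).1.form q (EuclideanSpace.single 0 1)
          (EuclideanSpace.single 0 1) = (1 + K * Real.arctan (u y)) ^ 2 ∧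
          0 < 1 + K * Real.arctan (u y)) ∧
      ∀ (N : ℕ) (A : EuclideanSpace ℝ (Fin N) →ₗ[ℝ] 𝓓(openInterval γ, ℝ)),
        ContDiff ℝ ∞ fun p : EuclideanSpace ℝ (Fin N) × Plane => (Φ (A p.1)).1.form p.2 := by
  have h0 := hpos 0
  have hl := hpos (Fin.last n)
  -- This makes `γ / h 0` half a period of the profile. The centres `1/hᵢ` lie at the distances `ξᵢ
  -- / h 0` from `ρ₀`, that is, at whole numbers of half periods.
  set κ : ℝ := Real.pi * h 0 / γ with hκdef
  have hκ : 0 < κ := div_pos (mul_pos Real.pi_pos h0) hγ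
  set ρ₀ : ℝ := 1 / h 0 with hρ₀def
  have hρ₀ : 0 < ρ₀ := by positivity
  set R : ℝ := 2 / h (Fin.last n) with hRdef
  have hR : 0 < R := by positivity
  have hRi : ∀ i, 2 / h i ≤ R := fun i => by
    have := hpos i
    rw [hRdef]
    gcongr
    exact hanti.antitone (Fin.le_last i)
  -- A half period starting at `ρ₀`, on which the cosine takes all its values, ends at `(1 + γ)/h 0
  -- ≤ 1/h (Fin.last n)`, inside the largest Hill's region.
  have hrange : ρ₀ + Real.pi / κ ≤ R := by
    have e1 : ρ₀ + Real.pi / κ = (1 + γ) / h 0 := by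
      have := Real.pi_pos
      rw [hρ₀def, hκdef]; field_simp
    have e2 : (1 + xi h (Fin.last n)) / h 0 = 1 / h (Fin.last n) := by
      rw [xi]; field_simp; ring
    have e3 : (1 + γ) / h 0 ≤ (1 + xi h (Fin.last n)) / h 0 := by gcongr
    rw [e1]
    refine e3.trans ?_
    rw [e2, hRdef]
    gcongr
    norm_num
  obtain ⟨c, δ, hc, hc', hδ, hwin⟩ := exists_window hκ ρ₀
  set P : (ℝ → ℝ) → ℝ → ℝ := zollProfile γ κ ρ₀ R c with hP
  have hout : ∀ (u : 𝓓(openInterval γ, ℝ)) (y : ℝ), y ∉ Set.Ioo 0 γ → u y = 0 := fun u y hy =>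
    image_eq_zero_of_notMem_tsupport fun hmem => hy (u.tsupport_subset hmem)
  have hzero : ∀ (u : 𝓓(openInterval γ, ℝ)) ρ, 0 ≤ ρ → ρ < δ → P u ρ = 0 := fun u ρ h1 h2 =>
    zollProfile_eq_zero hγ (hout u) (hwin ρ h1 h2)
  have hPpos : ∀ (u : 𝓓(openInterval γ, ℝ)) ρ, 0 < ρ → 0 < 1 + ρ * P u ρ := fun u ρ hρ =>
    zollProfile_pos hR.le hρ
  have hsm : ∀ {E : Type} [NormedAddCommGroup E] [NormedSpace ℝ E] {u : E → ℝ → ℝ},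
      (ContDiff ℝ ∞ fun p : E × ℝ => u p.1 p.2) →
      ContDiff ℝ ∞ fun p : E × ℝ => P (u p.1) p.2 := fun hu => contDiff_zollProfile hu
  have hPsm : ∀ u : 𝓓(openInterval γ, ℝ), ContDiff ℝ ∞ (P u) := fun u => by
    have h1 : ContDiff ℝ ∞ fun p : ℝ × ℝ => P u p.2 :=
      hsm (u := fun _ => u) (u.contDiff.comp contDiff_snd)
    exact ContDiff.comp (f := fun ρ : ℝ => (ρ, ρ)) h1 (by fun_prop)
  have hzoll : ∀ (u : 𝓓(openInterval γ, ℝ)) i,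
      IsZollAt (radialMetric (P u) (hPsm u) ⟨δ, hδ, hzero u⟩ (hPpos u)) keplerPotential
        (-(h i) / 2) := fun u i => by
    refine isZollAt_of_radialForm (hpos i) ((hPsm u).differentiable (by simp)) (fun ρ hρ => ?_)
      (hPpos u) fun q => rfl
    refine zollProfile_reflect (hρ.2.le.trans (hRi i)) (by linarith [hρ.1, hRi i]) ?_
    obtain ⟨k, hk⟩ := hmul i
    refine ⟨k, ?_⟩
    have hi := hpos i
    have e : 2 / h i - 2 * ρ₀ = 2 / h 0 * xi h i := by
      rw [hρ₀def, xi]; field_simp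
    rw [e, hk, hκdef]
    field_simp
  set Φ : 𝓓(openInterval γ, ℝ) → ZollMetric h := fun u =>
    ⟨radialMetric (P u) (hPsm u) ⟨δ, hδ, hzero u⟩ (hPpos u), radialMetric_rotInvariant, hzoll u⟩
    with hΦ
  have hform : ∀ u q, (Φ u).1.form q = radialForm (radialCoeff (P u) ‖q‖) q := fun u q => rfl
  refine ⟨Φ, fun y hy => ?_, fun N A => ?_⟩
  · -- the value of `u` at `y` is read off at a suitable radius
    obtain ⟨ρ, K, hρ, hρR, hK, hval⟩ := exists_radius hγ hκ hρ₀ hrange hc hc' hy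
    have hn : ‖(EuclideanSpace.single 0 ρ : Plane)‖ = ρ := by simp [abs_of_pos hρ]
    refine ⟨EuclideanSpace.single 0 ρ, ρ * K, ?_, mul_ne_zero hρ.ne' hK, fun u => ⟨?_, ?_⟩⟩
    · refine mem_totalHillRegion hpos (norm_pos_iff.1 (by rwa [hn])) (i := Fin.last n) ?_
      rwa [hn]
    · rw [hform, hn, radialForm_apply, mul_assoc, ← hval u]
      refine Eq.trans ?_ (sq_radialFactor (P u) hρ.ne')
      rw [inner_plane, inner_plane]
      simp
      ring
    · rw [mul_assoc, ← hval u]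
      exact hPpos u ρ hρ
  · have e : (fun p : EuclideanSpace ℝ (Fin N) × Plane => (Φ (A p.1)).1.form p.2) =
        fun p => radialForm (radialCoeff (P (A p.1)) ‖p.2‖) p.2 := funext fun p => hform _ _
    have hs : ContDiff ℝ ∞ fun p : EuclideanSpace ℝ (Fin N) × ℝ => P (A p.1) p.2 :=
      hsm (u := fun t => A t) (contDiff_linearMap_apply A)
    have hz : ∀ t ρ, 0 ≤ ρ → ρ < δ → P (A t) ρ = 0 := fun t => hzero (A t)
    clear_value Φ P
    rw [e]
    exact contDiff_radialForm (F := fun t => P (A t)) hs hδ hz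

/-- The embedding of the test functions on `(0, γ)` into the Zoll metrics. -/
theorem exists_zollMetric_embedding (hpos : ∀ i, 0 < h i) (hanti : StrictAnti h)
    {γ : ℝ} (hγ : 0 < γ) (hmul : ∀ i, ∃ k : ℤ, xi h i = k * γ) (hle : γ ≤ xi h (Fin.last n)) :
    ∃ Φ : 𝓓(openInterval γ, ℝ) → ZollMetric h,
      (Function.Injective fun u => Quotient.mk (zollSetoid h) (Φ u)) ∧
      ∀ (N : ℕ) (A : EuclideanSpace ℝ (Fin N) →ₗ[ℝ] 𝓓(openInterval γ, ℝ)),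
        Function.Injective A →
          IsSmoothNondegFamily h fun t => Quotient.mk (zollSetoid h) (Φ (A t)) := by
  obtain ⟨Φ, hpoint, hsmooth⟩ := exists_zollMetric_parametrization hpos hanti hγ hmul hle
  have hout : ∀ (u : 𝓓(openInterval γ, ℝ)) (y : ℝ), y ∉ Set.Ioo 0 γ → u y = 0 := fun u y hy =>
    image_eq_zero_of_notMem_tsupport fun hmem => hy (u.tsupport_subset hmem)
  refine ⟨Φ, fun u u' huu => ?_, fun N A hA =>
    ⟨fun t => Φ (A t), fun _ => rfl, hsmooth N A, ?_⟩⟩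
  · have heq : ∀ q ∈ totalHillRegion h, (Φ u).1.form q = (Φ u').1.form q := Quotient.exact huu
    ext y
    by_cases hy : y ∈ Set.Ioo 0 γ
    · obtain ⟨q, K, hq, hK, hval⟩ := hpoint y hy
      obtain ⟨e1, p1⟩ := hval u
      obtain ⟨e2, p2⟩ := hval u'
      -- Both radial factors are positive, so equal squares give equal factors; then `arctan` is
      -- injective.
      rw [heq q hq, e2, pow_left_inj₀ p2.le p1.le two_ne_zero] at e1
      have := mul_left_cancel₀ hK (add_left_cancel e1)
      exact (Real.arctan_injective this).symm
    · rw [hout u y hy, hout u' y hy]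
  · intro t u hu
    have hAu : A u ≠ 0 := fun h1 => hu (hA (by rw [h1, map_zero]))
    obtain ⟨y, hy⟩ : ∃ y, A u y ≠ 0 := by
      by_contra hcon
      push Not at hcon
      exact hAu (TestFunction.ext hcon)
    have hyI : y ∈ Set.Ioo 0 γ := by
      by_contra hcon
      exact hy (hout _ y hcon)
    obtain ⟨q, K, hq, hK, hval⟩ := hpoint y hyI
    refine ⟨q, hq, fun hder => ?_⟩
    have hdiff : DifferentiableAt ℝ (fun s => (Φ (A s)).1.form q) t := by
      have h1 : ContDiff ℝ ∞ fun s => (Φ (A s)).1.form q :=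
        ContDiff.comp (f := fun s : EuclideanSpace ℝ (Fin N) => (s, q)) (hsmooth N A) (by fun_prop)
      exact h1.differentiable (by simp) t
    have hline : HasDerivAt (fun τ : ℝ => t + τ • u) u 0 := by
      simpa using ((hasDerivAt_id (0 : ℝ)).smul_const u).const_add t
    have hd1 := (hdiff.hasFDerivAt.clm_apply
      (hasFDerivAt_const (EuclideanSpace.single 0 1 : Plane) t)).clm_apply
      (hasFDerivAt_const (EuclideanSpace.single 0 1 : Plane) t)
    have hd2 := hd1.comp_hasDerivAt_of_eq (0 : ℝ) hline (by simp)
    have hlin : ∀ τ : ℝ, A (t + τ • u) y = A t y + τ * A u y := fun τ => by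
      rw [map_add, map_smul]; rfl
    have hd3 : HasDerivAt (fun τ : ℝ => (1 + K * Real.arctan (A t y + τ * A u y)) ^ 2)
        (2 * (1 + K * Real.arctan (A t y)) * (K * (1 / (1 + A t y ^ 2) * A u y))) 0 := by
      have h1 : HasDerivAt (fun τ : ℝ => A t y + τ * A u y) (A u y) 0 := by
        simpa using ((hasDerivAt_id (0 : ℝ)).mul_const (A u y)).const_add (A t y)
      have h2 := ((h1.arctan.const_mul K).const_add 1).pow 2
      exact h2.congr_deriv (by simp)
    have heq : ((fun s => (Φ (A s)).1.form q (EuclideanSpace.single 0 1)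
        (EuclideanSpace.single 0 1)) ∘ fun τ : ℝ => t + τ • u) =
        fun τ : ℝ => (1 + K * Real.arctan (A t y + τ * A u y)) ^ 2 := by
      ext τ
      rw [← hlin]
      exact (hval _).1
    rw [heq] at hd2
    have huniq := hd2.unique hd3
    -- The directional derivative is a product of nonzero factors: the radial factor, `K`, the
    -- derivative of `arctan`, and the value of `A u` at the chosen `y`.
    have hne : 2 * (1 + K * Real.arctan (A t y)) * (K * (1 / (1 + A t y ^ 2) * A u y)) ≠ 0 := by
      have := (hval (A t)).2.ne'
      have : 1 + A t y ^ 2 ≠ 0 := by positivity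
      positivity
    exact hne (huniq.symm.trans (by simp [hder]))

end Family

/-! ### The main theorem -/

theorem corollary3 (n : ℕ) (hn : 1 ≤ n) (h : Fin (n + 1) → ℝ) (h_anti : StrictAnti h)
    (h_pos : ∀ i, 0 < h i) (h_dep : ∀ i j, RatDependent (xi h i) (xi h j)) :
    IsLeast (posCombinations h) (gammaInf h) ∧
    ZollSpaceInfiniteDimensional h ∧
    ∃ (S : Set (ZollSpace h)) (e : 𝓓(openInterval (gammaInf h), ℝ) ≃ S),
      ∀ (N : ℕ) (A : EuclideanSpace ℝ (Fin N) →ₗ[ℝ] 𝓓(openInterval (gammaInf h), ℝ)),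
        Function.Injective A → IsSmoothNondegFamily h (fun t => (e (A t) : ZollSpace h)) := by
  -- There are `n + 1 ≥ 2` levels, so the last `ξ` is positive and supplies a positive combination.
  have hlast : 0 < xi h (Fin.last n) := by
    have h1 : (0 : Fin (n + 1)) < Fin.last n := by
      exact Fin.lt_def.2 <| by simpa using Nat.pos_of_ne_zero (by omega)
    have h2 := h_pos (Fin.last n)
    have := (one_lt_div h2).2 (h_anti h1)
    rw [xi]; linarith
  have hleast := isLeast_gammaInf h_dep hlast
  have hγ : 0 < gammaInf h := hleast.1.1
  have hmul := xi_eq_mul_of_isLeast hleast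
  have hle : gammaInf h ≤ xi h (Fin.last n) := by
    obtain ⟨k, hk⟩ := hmul (Fin.last n)
    have hk0 : (0 : ℝ) < k := by
      rw [hk] at hlast
      exact (mul_pos_iff_of_pos_right hγ).1 hlast
    have hk1 : (1 : ℝ) ≤ k := by
      have : 0 < k := by exact_mod_cast hk0
      exact_mod_cast this
    rw [hk]; nlinarith
  obtain ⟨Φ, hinj, hfam⟩ := exists_zollMetric_embedding h_pos h_anti hγ hmul hle
  refine ⟨hleast, fun N => ?_, Set.range fun u => Quotient.mk (zollSetoid h) (Φ u),
    Equiv.ofInjective _ hinj, fun N A hA => hfam N A hA⟩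
  obtain ⟨A, hA⟩ := exists_injective_linearMap hγ N
  exact ⟨_, hinj.comp hA, hfam N A hA⟩
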